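/- Let $N\ge 1$ and $\alpha\in\mathbb R$. For $\mathbf x=(x,y)\in\mathbb R^2\setminus\{0\}$ put $\mathbf x^{-\perp}=(-y,x)/(x^2+y^2)$. On functions of $(\mathbf x_1,\dots,\mathbf x_N)\in(\mathbb R^2)^N$ consider the magnetic derivatives $$D_j=-i\nabla_{\mathbf x_j}+\alpha\sum_{k\ne j}(\mathbf x_j-\mathbf x_k)^{-\perp},\qquad 1\le j\le N .$$ Let $\Delta=\{\mathbf x_j=\mathbf x_k\text{ for some }j\neq k\}\subset\mathbb R^{2N}$, and let $\mathscr D^N_\alpha\subset L^2_{\mathrm{sym}}(\mathbb R^{2N};\mathbb C)$ be the domain of the closure in $L^2$ of the operator $(D_j)_{j=1}^N$ defined on the smooth, permutation-symmetric functions with compact support in $\mathbb R^{2N}\setminus\Delta$; for $\Psi\in\mathscr D^N_\alpha$, $D_j\Psi\in L^2(\mathbb R^{2N};\mathbb C^2)$ denotes the action of this closure. With $Q_0=[0,1]^2$, define the Neumann ground-state energy of $N$ ideal anyons on the unit square by $$E_N^{\mathcal N}(\alpha)=\inf\Bigl\{\sum_{j=1}^N\int_{Q_0^N}|D_j\Psi|^2\;:\;\Psi\in\mathscr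 D^N_\alpha,\ \int_{Q_0^N}|\Psi|^2=1\Bigr\}.$$ **Lemma.** For all $0\le\alpha\le 1$ and all integers $N\ge 2$, $$E_N^{\mathcal N}(\alpha)\ \ge\ \frac N4\,\min\bigl\{E_2^{\mathcal N}(\alpha),\,E_3^{\mathcal N}(\alpha),\,E_4^{\mathcal N}(\alpha)\bigr\}.$$ -/

import Mathlib

open MeasureTheory Filter Topology
open scoped ContDiff

namespace Anyon

noncomputable section

/-- The one-particle space `ℝ²`. -/
abbrev Plane : Type := EuclideanSpace ℝ (Fin 2)

/-- The `N`-particle configuration space `ℝ^{2N} = (ℝ²)^N`, with its Lebesgue measure. -/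
abbrev Config (N : ℕ) : Type := Fin N → Plane

/-- `x^{-⊥} = (-y, x) / (x² + y²)` for `x = (x, y)`: the Aharonov-Bohm potential of flux `2π`. -/
def perpInv (x : Plane) : Plane :=
  !₂[-(x 1) / (x 0 ^ 2 + x 1 ^ 2), (x 0) / (x 0 ^ 2 + x 1 ^ 2)]

/-- The magnetic potential `A_j(x) = ∑_{k ≠ j} (x_j - x_k)^{-⊥}` seen by particle `j`. -/
def vecPot {N : ℕ} (j : Fin N) (x : Config N) : Plane :=
  ∑ k ∈ Finset.univ.erase j, perpInv (x j - x k)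

/-- The set of coincidence configurations, on which at least two particles sit at the same point. -/
def fatDiagonal (N : ℕ) : Set (Config N) :=
  {x | ∃ j k : Fin N, j ≠ k ∧ x j = x k}

/-- The partial derivative of `Φ` at `x` in the `k`-th coordinate of the `j`-th particle. -/
def partialDeriv {N : ℕ} (Φ : Config N → ℂ) (j : Fin N) (k : Fin 2) (x : Config N) : ℂ :=
  fderiv ℝ Φ x (Pi.single j (EuclideanSpace.single k (1 : ℝ)))

/-- The `k`-th component of `D_j Φ = (-i ∇_j + α A_j) Φ`, for a differentiable function `Φ`. -/
def magDeriv {N : ℕ} (α : ℝ) (Φ : Config N → ℂ) (j : Fin N) (k : Fin 2) (x : Config N) : ℂ :=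
  -Complex.I * partialDeriv Φ j k x + (α : ℂ) * ((vecPot j x k : ℝ) : ℂ) * Φ x

/-- The core `C_c^∞(ℝ^{2N} \ Δ)_sym`: smooth permutation-symmetric functions whose support is
compact and contains no coincidence configuration. -/
structure IsCore {N : ℕ} (Φ : Config N → ℂ) : Prop where
  smooth : ContDiff ℝ ∞ Φ
  compactSupport : HasCompactSupport Φ
  offDiagonal : Disjoint (tsupport Φ) (fatDiagonal N)
  symmetric : ∀ (σ : Equiv.Perm (Fin N)) (x : Config N), Φ (fun j => x (σ j)) = Φ x

/-- `IsMagDeriv α Ψ F`: the function `Ψ` lies in the form domain, i.e. the domain of the closure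
in `L²` of the operator `(D_j)_j` on the core, and `F j k` is the `k`-th component of `D_j Ψ`.
This is the graph of the closed operator: `Ψ` is an `L²`-limit of functions `Φ n` of the core
such that `D_j (Φ n)` converges to `F j` in `L²` for all `j`.
Permutation symmetry (almost everywhere) of `Ψ` passes to the limit. -/
structure IsMagDeriv {N : ℕ} (α : ℝ) (Ψ : Config N → ℂ) (F : Fin N → Fin 2 → Config N → ℂ) :
    Prop where
  memLp : MemLp Ψ 2 volume
  memLp_deriv : ∀ j k, MemLp (F j k) 2 volume
  approx : ∃ Φ : ℕ → Config N → ℂ, (∀ n, IsCore (Φ n)) ∧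
    Tendsto (fun n => eLpNorm (fun x => Φ n x - Ψ x) 2 volume) atTop (𝓝 0) ∧
    ∀ j k, Tendsto (fun n => eLpNorm (fun x => magDeriv α (Φ n) j k x - F j k x) 2 volume)
      atTop (𝓝 0)

/-- `Ω^N`, the configurations with all particles in `Ω`. -/
def domainPow (N : ℕ) (Ω : Set Plane) : Set (Config N) :=
  {x | ∀ j, x j ∈ Ω}

/-- The possible values of `∑_j ∫_{Ω^N} |D_j Ψ|²` with `Ψ` in the form domain and
`∫_{Ω^N} |Ψ|² = 1`. -/
def neumannEnergies (N : ℕ) (α : ℝ) (Ω : Set Plane) : Set ℝ :=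
  {e | ∃ (Ψ : Config N → ℂ) (F : Fin N → Fin 2 → Config N → ℂ), IsMagDeriv α Ψ F ∧
    ∫ x in domainPow N Ω, ‖Ψ x‖ ^ 2 = 1 ∧
    e = ∑ j, ∫ x in domainPow N Ω, ∑ k, ‖F j k x‖ ^ 2}

/-- The Neumann ground-state energy of `N` ideal anyons on `Ω`. -/
def neumannEnergyOn (N : ℕ) (α : ℝ) (Ω : Set Plane) : ℝ :=
  sInf (neumannEnergies N α Ω)

/-- The unit square `Q₀ = [0,1]²`. -/
def unitSquare : Set Plane :=
  {x | ∀ i, x i ∈ Set.Icc (0 : ℝ) 1}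

/-- The Neumann ground-state energy of `N` ideal anyons on the unit square. -/
def neumannEnergy (N : ℕ) (α : ℝ) : ℝ :=
  neumannEnergyOn N α unitSquare

end

end Anyon

namespace Anyon

/-! The proof is by strong induction on N, using a superadditivity estimate over the four quadrants
of the square. Suppose n particles lie in a quadrant and the others are frozen outside it. The field
of each frozen particle is a gradient on the quadrant, so a unimodular symmetric phase removes it
(`CoreBound.slice`). What remains is the n-particle problem on a square of side 1/2, whose energy
bound is 4 times that of the unit square (`CoreBound.halfBox`). Integrating over the frozen
positions and summing over quadrants gives `setIntegral_occupants_le`: the energy dominates the mass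
weighted by the sum of 4 E_n over the occupation numbers n.

Let m be the minimum of E_2, E_3, E_4, and N ≥ 5. If the particles are not all in one quadrant,
induction bounds 4 E_n by n m for each occupation number n ≥ 2, and at most three particles are
alone, so the weight is at least (N - 3) m. Otherwise the weight is at least 4 E_N. Hence E_N ≥
min(4 E_N, (N - 3) m), which gives E_N ≥ (N - 3) m ≥ N m / 4 as soon as E_N > 0.

For m > 0, positivity is a separate argument (`IsWeight.exists_coreBound_pos`). Moving one particle
to the neighbouring quadrant takes a clustered configuration to one of weight at least 2m. The
diamagnetic inequality controls the change of |Φ|² along the move by the kinetic energy and a small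
fraction of the mass. -/

/-! ### The Aharonov-Bohm potential -/

theorem perpInv_zero : perpInv 0 = 0 := by
  ext i
  fin_cases i <;> simp [perpInv]

theorem perpInv_apply_zero (x : Plane) : perpInv x 0 = -(x 1) / (x 0 ^ 2 + x 1 ^ 2) := by
  simp [perpInv]

theorem perpInv_apply_one (x : Plane) : perpInv x 1 = x 0 / (x 0 ^ 2 + x 1 ^ 2) := by
  simp [perpInv]

theorem perpInv_smul (r : ℝ) (x : Plane) : perpInv (r • x) = r⁻¹ • perpInv x := by
  by_cases hr : r = 0
  · simp [hr, perpInv_zero]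
  ext i
  fin_cases i
  · simp only [Fin.zero_eta, perpInv_apply_zero, PiLp.smul_apply, smul_eq_mul]
    rw [show (r * x 0) ^ 2 + (r * x 1) ^ 2 = r * (r * (x 0 ^ 2 + x 1 ^ 2)) by ring,
      show -(r * x 1) = r * (-(x 1)) by ring, mul_div_mul_left _ _ hr]
    field_simp
  · simp only [Fin.mk_one, perpInv_apply_one, PiLp.smul_apply, smul_eq_mul]
    rw [show (r * x 0) ^ 2 + (r * x 1) ^ 2 = r * (r * (x 0 ^ 2 + x 1 ^ 2)) by ring,
      mul_div_mul_left _ _ hr]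
    field_simp

theorem sq_add_sq_ne_zero {x : Plane} (hx : x ≠ 0) : x 0 ^ 2 + x 1 ^ 2 ≠ 0 := by
  intro h
  apply hx
  ext i
  fin_cases i
  · have : x 0 = 0 := by nlinarith [sq_nonneg (x 0), sq_nonneg (x 1)]
    simpa using this
  · have : x 1 = 0 := by nlinarith [sq_nonneg (x 0), sq_nonneg (x 1)]
    simpa using this

theorem continuousAt_perpInv_apply {x : Plane} (hx : x ≠ 0) (i : Fin 2) :
    ContinuousAt (fun y => perpInv y i) x := by
  have h := sq_add_sq_ne_zero hx
  have c : ∀ k : Fin 2, ContinuousAt (fun y : Plane => y k) x := fun k => by fun_prop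
  fin_cases i
  · simp only [Fin.zero_eta, perpInv_apply_zero]
    exact (c 1).neg.div (((c 0).pow 2).add ((c 1).pow 2)) h
  · simp only [Fin.mk_one, perpInv_apply_one]
    exact (c 0).div (((c 0).pow 2).add ((c 1).pow 2)) h

variable {N : ℕ}

/-- The self-term vanishes by the convention 0/0 = 0; the full sum is easier to reindex. -/
theorem vecPot_eq_sum (j : Fin N) (x : Config N) : vecPot j x = ∑ k, perpInv (x j - x k) := by
  rw [vecPot, ← Finset.add_sum_erase _ _ (Finset.mem_univ j)]
  simp [perpInv_zero]

theorem vecPot_apply (j : Fin N) (x : Config N) (i : Fin 2) :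
    vecPot j x i = ∑ k ∈ Finset.univ.erase j, perpInv (x j - x k) i := by
  rw [vecPot, WithLp.ofLp_sum, Finset.sum_apply]

theorem vecPot_apply' (j : Fin N) (x : Config N) (i : Fin 2) :
    vecPot j x i = ∑ k, perpInv (x j - x k) i := by
  rw [vecPot_eq_sum, WithLp.ofLp_sum, Finset.sum_apply]

theorem continuousAt_vecPot_apply {x : Config N} (hx : x ∉ fatDiagonal N) (j : Fin N)
    (i : Fin 2) : ContinuousAt (fun y => vecPot j y i) x := by
  simp only [vecPot_apply]
  refine tendsto_finsetSum _ fun k hk => ?_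
  have hne : x j - x k ≠ 0 := fun h =>
    hx ⟨j, k, (Finset.ne_of_mem_erase hk).symm, sub_eq_zero.1 h⟩
  exact ContinuousAt.comp (f := fun y : Config N => y j - y k)
    (continuousAt_perpInv_apply hne i) (by fun_prop)

/-! ### Core functions and their magnetic derivatives -/

namespace IsCore

variable {Φ : Config N → ℂ}

theorem differentiable (h : IsCore Φ) : Differentiable ℝ Φ :=
  h.smooth.differentiable (by simp)

theorem continuous (h : IsCore Φ) : Continuous Φ := h.smooth.continuous

theorem continuous_partialDeriv (h : IsCore Φ) (j : Fin N) (k : Fin 2) :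
    Continuous (partialDeriv Φ j k) :=
  (h.smooth.continuous_fderiv (by simp)).clm_apply continuous_const

theorem partialDeriv_eq_zero {x : Config N} (hx : x ∉ tsupport Φ) (j : Fin N) (k : Fin 2) :
    partialDeriv Φ j k x = 0 := by
  have h0 : Φ =ᶠ[𝓝 x] fun _ => 0 := notMem_tsupport_iff_eventuallyEq.1 hx
  rw [partialDeriv, h0.fderiv_eq]
  simp

theorem magDeriv_eq_zero {x : Config N} (α : ℝ) (hx : x ∉ tsupport Φ) (j : Fin N) (k : Fin 2) :
    magDeriv α Φ j k x = 0 := by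
  simp [magDeriv, partialDeriv_eq_zero hx, image_eq_zero_of_notMem_tsupport hx]

/-- The potential is singular only on the diagonal, and near the diagonal the core function
vanishes. -/
theorem continuous_magDeriv (h : IsCore Φ) (α : ℝ) (j : Fin N) (k : Fin 2) :
    Continuous (magDeriv α Φ j k) := by
  rw [continuous_iff_continuousAt]
  intro x
  by_cases hx : x ∈ tsupport Φ
  · have hd : x ∉ fatDiagonal N := Set.disjoint_left.1 h.offDiagonal hx
    have hv : ContinuousAt (fun y => ((vecPot j y k : ℝ) : ℂ)) x :=
      Complex.continuous_ofReal.continuousAt.comp (continuousAt_vecPot_apply hd j k)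
    exact (continuousAt_const.mul (h.continuous_partialDeriv j k).continuousAt).add
      ((continuousAt_const.mul hv).mul h.continuous.continuousAt)
  · have h0 : magDeriv α Φ j k =ᶠ[𝓝 x] fun _ => 0 :=
      eventually_of_mem ((isClosed_tsupport Φ).isOpen_compl.mem_nhds hx)
        fun y hy => magDeriv_eq_zero α hy j k
    exact h0.continuousAt

theorem hasCompactSupport_magDeriv (h : IsCore Φ) (α : ℝ) (j : Fin N) (k : Fin 2) :
    HasCompactSupport (magDeriv α Φ j k) :=
  HasCompactSupport.intro h.compactSupport fun _ hx => magDeriv_eq_zero α hx j k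

theorem memLp (h : IsCore Φ) : MemLp Φ 2 volume :=
  h.continuous.memLp_of_hasCompactSupport h.compactSupport

theorem memLp_magDeriv (h : IsCore Φ) (α : ℝ) (j : Fin N) (k : Fin 2) :
    MemLp (magDeriv α Φ j k) 2 volume :=
  (h.continuous_magDeriv α j k).memLp_of_hasCompactSupport (h.hasCompactSupport_magDeriv α j k)

theorem isMagDeriv (h : IsCore Φ) (α : ℝ) : IsMagDeriv α Φ (magDeriv α Φ) where
  memLp := h.memLp
  memLp_deriv := h.memLp_magDeriv α
  approx := ⟨fun _ => Φ, fun _ => h, by simp, by simp⟩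

theorem const_mul (h : IsCore Φ) (c : ℂ) : IsCore fun x => c * Φ x where
  smooth := contDiff_const.mul h.smooth
  compactSupport := h.compactSupport.mul_left
  offDiagonal := h.offDiagonal.mono_left (tsupport_mul_subset_right (f := fun _ => c))
  symmetric σ x := by rw [h.symmetric σ x]

theorem magDeriv_const_mul (h : IsCore Φ) (α : ℝ) (c : ℂ) (j : Fin N) (k : Fin 2)
    (x : Config N) : magDeriv α (fun x => c * Φ x) j k x = c * magDeriv α Φ j k x := by
  simp only [magDeriv, partialDeriv]
  rw [fderiv_const_mul (h.differentiable x)]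
  simp only [_root_.smul_apply, smul_eq_mul]
  ring

end IsCore

/-! ### Energy bounds on the core and on the closure -/

/-- The pointwise kinetic energy of particle `j`. -/
noncomputable def kinetic (α : ℝ) (Φ : Config N → ℂ) (j : Fin N) (x : Config N) : ℝ :=
  ∑ k, ‖magDeriv α Φ j k x‖ ^ 2

theorem kinetic_nonneg (α : ℝ) (Φ : Config N → ℂ) (j : Fin N) (x : Config N) :
    0 ≤ kinetic α Φ j x := by
  unfold kinetic; positivity

theorem IsCore.continuous_kinetic {Φ : Config N → ℂ} (h : IsCore Φ) (α : ℝ) (j : Fin N) :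
    Continuous (kinetic α Φ j) :=
  continuous_finsetSum _ fun k _ => (h.continuous_magDeriv α j k).norm.pow 2

theorem IsCore.integrable_kinetic {Φ : Config N → ℂ} (h : IsCore Φ) (α : ℝ) (j : Fin N) :
    Integrable (kinetic α Φ j) := by
  refine (h.continuous_kinetic α j).integrable_of_hasCompactSupport
    (HasCompactSupport.intro h.compactSupport fun x hx => ?_)
  simp [kinetic, IsCore.magDeriv_eq_zero α hx]

theorem IsCore.integrable_norm_sq {Φ : Config N → ℂ} (h : IsCore Φ) :
    Integrable fun x => ‖Φ x‖ ^ 2 := by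
  refine (h.continuous.norm.pow 2).integrable_of_hasCompactSupport
    (HasCompactSupport.intro h.compactSupport fun x hx => ?_)
  simp [image_eq_zero_of_notMem_tsupport hx]

/-- `c` bounds the Neumann energy on `Ω^n` from below, on the core. -/
def CoreBound (n : ℕ) (α : ℝ) (Ω : Set Plane) (c : ℝ) : Prop :=
  ∀ φ : Config n → ℂ, IsCore φ →
    c * ∫ x in domainPow n Ω, ‖φ x‖ ^ 2 ≤ ∫ x in domainPow n Ω, ∑ j, kinetic α φ j x

theorem coreBound_zero (n : ℕ) (α : ℝ) (Ω : Set Plane) : CoreBound n α Ω 0 := by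
  intro φ _
  rw [zero_mul]
  exact integral_nonneg fun x => Finset.sum_nonneg fun j _ => kinetic_nonneg α φ j x

theorem nonneg_of_mem_neumannEnergies {α : ℝ} {Ω : Set Plane} {e : ℝ}
    (he : e ∈ neumannEnergies N α Ω) : 0 ≤ e := by
  obtain ⟨Ψ, F, -, -, rfl⟩ := he
  exact Finset.sum_nonneg fun j _ => integral_nonneg fun x => by positivity

theorem neumannEnergyOn_nonneg (N : ℕ) (α : ℝ) (Ω : Set Plane) : 0 ≤ neumannEnergyOn N α Ω :=
  Real.sInf_nonneg fun _ h => nonneg_of_mem_neumannEnergies h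

theorem coreBound_neumannEnergyOn (N : ℕ) (α : ℝ) (Ω : Set Plane) :
    CoreBound N α Ω (neumannEnergyOn N α Ω) := by
  intro φ hφ
  set M := ∫ x in domainPow N Ω, ‖φ x‖ ^ 2 with hM
  have hM0 : 0 ≤ M := integral_nonneg fun x => by positivity
  rcases hM0.eq_or_lt with h0 | h0
  · rw [← h0, mul_zero]
    exact integral_nonneg fun x => Finset.sum_nonneg fun j _ => kinetic_nonneg α φ j x
  -- Normalising factor: `c * φ` has unit mass on the domain.
  set c : ℂ := (((√M)⁻¹ : ℝ) : ℂ) with hc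
  have hcn : ‖c‖ ^ 2 = M⁻¹ := by
    rw [hc, Complex.norm_real, Real.norm_eq_abs, sq_abs, inv_pow, Real.sq_sqrt hM0]
  have hmem : M⁻¹ * ∫ x in domainPow N Ω, ∑ j, kinetic α φ j x ∈ neumannEnergies N α Ω := by
    refine ⟨fun x => c * φ x, _, (hφ.const_mul c).isMagDeriv α, ?_, ?_⟩
    · simp only [norm_mul, mul_pow, hcn]
      rw [integral_const_mul, ← hM, inv_mul_cancel₀ h0.ne']
    · simp only [hφ.magDeriv_const_mul, norm_mul, mul_pow, hcn]
      rw [integral_finsetSum _ fun j _ => (hφ.integrable_kinetic α j).integrableOn,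
        Finset.mul_sum]
      refine Finset.sum_congr rfl fun j _ => ?_
      rw [← integral_const_mul]
      simp only [kinetic, Finset.mul_sum]
  have hle := csInf_le ⟨0, fun _ h => nonneg_of_mem_neumannEnergies h⟩ hmem
  calc neumannEnergyOn N α Ω * M ≤ (M⁻¹ * ∫ x in domainPow N Ω, ∑ j, kinetic α φ j x) * M :=
        mul_le_mul_of_nonneg_right hle hM0
    _ = _ := by field_simp

theorem tendsto_setIntegral_norm_sq {X : Type*} [MeasurableSpace X] {μ : Measure X}
    {f : ℕ → X → ℂ} {g : X → ℂ} (hf : ∀ n, MemLp (f n) 2 μ) (hg : MemLp g 2 μ)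
    (h : Tendsto (fun n => eLpNorm (fun x => f n x - g x) 2 μ) atTop (𝓝 0)) (s : Set X) :
    Tendsto (fun n => ∫ x in s, ‖f n x‖ ^ 2 ∂μ) atTop (𝓝 (∫ x in s, ‖g x‖ ^ 2 ∂μ)) := by
  have hf' : ∀ n, MemLp (f n) 2 (μ.restrict s) := fun n => (hf n).restrict s
  have hg' : MemLp g 2 (μ.restrict s) := hg.restrict s
  have h' : Tendsto (fun n => eLpNorm (f n - g) 2 (μ.restrict s)) atTop (𝓝 0) :=
    tendsto_of_tendsto_of_tendsto_of_le_of_le tendsto_const_nhds h (fun _ => bot_le)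
      fun n => eLpNorm_mono_measure _ Measure.restrict_le_self
  have hL := (Lp.tendsto_Lp_iff_tendsto_eLpNorm'' f hf' g hg').2 h'
  have key : ∀ (u : X → ℂ) (hu : MemLp u 2 (μ.restrict s)),
      ∫ x in s, ‖u x‖ ^ 2 ∂μ = ‖hu.toLp u‖ ^ 2 := by
    intro u hu
    rw [Lp.norm_toLp, eLpNorm_eq_lintegral_rpow_enorm_toReal (by simp) (by simp)]
    have hm : AEStronglyMeasurable (fun x => ‖u x‖ ^ 2) (μ.restrict s) :=
      hu.aestronglyMeasurable.norm.pow 2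
    rw [integral_eq_lintegral_of_nonneg_ae (ae_of_all _ fun x => sq_nonneg _) hm]
    rw [← ENNReal.toReal_pow]
    congr 1
    simp only [ENNReal.toReal_ofNat, one_div]
    rw [← ENNReal.rpow_natCast, ← ENNReal.rpow_mul]
    norm_num
  rw [key g hg']
  simp only [fun n => key (f n) (hf' n)]
  exact hL.norm.pow 2

/-- Mass and energy on the domain are both continuous along the L² approximation by core functions,
so a bound on the core passes to the closure. -/
theorem CoreBound.le_of_mem_neumannEnergies {α : ℝ} {Ω : Set Plane} {c e : ℝ}
    (h : CoreBound N α Ω c) (he : e ∈ neumannEnergies N α Ω) : c ≤ e := by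
  obtain ⟨Ψ, F, hF, hΨ, rfl⟩ := he
  obtain ⟨Φ, hΦ, hΦΨ, hΦF⟩ := hF.approx
  have t1 := (tendsto_setIntegral_norm_sq (fun n => (hΦ n).memLp) hF.memLp hΦΨ
    (domainPow N Ω)).const_mul c
  rw [hΨ, mul_one] at t1
  have t2 : Tendsto (fun n => ∑ j, ∑ k, ∫ x in domainPow N Ω, ‖magDeriv α (Φ n) j k x‖ ^ 2)
      atTop (𝓝 (∑ j, ∑ k, ∫ x in domainPow N Ω, ‖F j k x‖ ^ 2)) :=
    tendsto_finsetSum _ fun j _ => tendsto_finsetSum _ fun k _ =>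
      tendsto_setIntegral_norm_sq (fun n => (hΦ n).memLp_magDeriv α j k) (hF.memLp_deriv j k)
        (hΦF j k) _
  have hsq : ∀ j k, IntegrableOn (fun x => ‖F j k x‖ ^ 2) (domainPow N Ω) := fun j k =>
    (hF.memLp_deriv j k).integrable_norm_pow (by simp) |>.integrableOn
  have e2 : ∑ j, ∫ x in domainPow N Ω, ∑ k, ‖F j k x‖ ^ 2 =
      ∑ j, ∑ k, ∫ x in domainPow N Ω, ‖F j k x‖ ^ 2 :=
    Finset.sum_congr rfl fun j _ => integral_finsetSum _ fun k _ => hsq j k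
  rw [e2]
  refine le_of_tendsto_of_tendsto' t1 t2 fun n => (h (Φ n) (hΦ n)).trans_eq ?_
  rw [integral_finsetSum _ fun j _ => ((hΦ n).integrable_kinetic α j).integrableOn]
  refine Finset.sum_congr rfl fun j _ => ?_
  exact integral_finsetSum _ fun k _ =>
    (((hΦ n).memLp_magDeriv α j k).integrable_norm_pow (by simp)).integrableOn

/-! ### The form domain contains normalized functions -/

theorem isClosed_fatDiagonal (N : ℕ) : IsClosed (fatDiagonal N) := by
  have : fatDiagonal N = ⋃ j : Fin N, ⋃ k : Fin N, ⋃ _ : j ≠ k, {x | x j = x k} := by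
    ext x; simp [fatDiagonal]
  rw [this]
  refine isClosed_iUnion_of_finite fun j => isClosed_iUnion_of_finite fun k =>
    isClosed_iUnion_of_finite fun _ => isClosed_eq (by fun_prop) (by fun_prop)

theorem perm_mem_fatDiagonal {x : Config N} (σ : Equiv.Perm (Fin N)) (hx : x ∈ fatDiagonal N) :
    (fun j => x (σ j)) ∈ fatDiagonal N := by
  obtain ⟨j, k, hjk, h⟩ := hx
  exact ⟨σ.symm j, σ.symm k, fun h => hjk (σ.symm.injective h), by simpa using h⟩

theorem isCore_sum_perm {f : Config N → ℝ} (hf : ContDiff ℝ ∞ f) (hc : HasCompactSupport f)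
    (hd : tsupport f ⊆ (fatDiagonal N)ᶜ) :
    IsCore fun x : Config N => ((∑ σ : Equiv.Perm (Fin N), f fun j => x (σ j) : ℝ) : ℂ) := by
  let P : Equiv.Perm (Fin N) → (Config N ≃ₜ Config N) := fun σ =>
    { toFun := fun x j => x (σ j)
      invFun := fun x j => x (σ.symm j)
      left_inv := fun x => by simp
      right_inv := fun x => by simp
      continuous_toFun := by fun_prop
      continuous_invFun := by fun_prop }
  let K : Set (Config N) := ⋃ σ, P σ ⁻¹' tsupport f
  have hK : IsCompact K := isCompact_iUnion fun σ => (P σ).isCompact_preimage.2 hc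
  have h0 : ∀ x ∉ K, ((∑ σ : Equiv.Perm (Fin N), f fun j => x (σ j) : ℝ) : ℂ) = 0 := by
    intro x hx
    rw [Complex.ofReal_eq_zero]
    refine Finset.sum_eq_zero fun σ _ => ?_
    exact image_eq_zero_of_notMem_tsupport fun h => hx (Set.mem_iUnion.2 ⟨σ, h⟩)
  refine ⟨?_, HasCompactSupport.intro hK h0, ?_, ?_⟩
  · refine Complex.ofRealCLM.contDiff.comp (ContDiff.sum fun σ _ => hf.comp ?_)
    exact contDiff_pi.2 fun j => contDiff_apply ℝ Plane (σ j)
  · have hsub : tsupport (fun x : Config N =>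
        ((∑ σ : Equiv.Perm (Fin N), f fun j => x (σ j) : ℝ) : ℂ)) ⊆ K :=
      closure_minimal (fun x hx => by_contra fun h => hx (h0 x h)) hK.isClosed
    rw [Set.disjoint_left]
    intro x hx hxd
    obtain ⟨σ, hσ⟩ := Set.mem_iUnion.1 (hsub hx)
    exact hd hσ (perm_mem_fatDiagonal σ hxd)
  · intro τ x
    congr 1
    exact Fintype.sum_equiv (Equiv.mulLeft τ) _ _ fun σ => rfl

theorem exists_isCore_integral_pos (N : ℕ) :
    ∃ φ : Config N → ℂ, IsCore φ ∧ 0 < ∫ x in domainPow N unitSquare, ‖φ x‖ ^ 2 := by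
  -- Distinct points on the horizontal midline, interior to the square, around which a bump avoids
  -- the diagonal.
  let c : Config N := fun j => !₂[((j : ℝ) + 1) / (N + 1), 1 / 2]
  have hcd : c ∉ fatDiagonal N := by
    rintro ⟨j, k, hjk, h⟩
    have h0 := congrArg (fun p : Plane => p 0) h
    have hN : (N : ℝ) + 1 ≠ 0 := by positivity
    simp only [c, Matrix.cons_val_zero] at h0
    rw [div_left_inj' hN, add_left_inj] at h0
    exact hjk (Fin.ext (by exact_mod_cast h0))
  let U : Set (Config N) := {x | ∀ j i, x j i ∈ Set.Ioo (0 : ℝ) 1}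
  have hUo : IsOpen U := by
    simp only [U, Set.ofPred_forall]
    exact isOpen_iInter_of_finite fun j => isOpen_iInter_of_finite fun i =>
      isOpen_Ioo.preimage (by fun_prop)
  have hUs : U ⊆ domainPow N unitSquare := fun x hx j i => Set.Ioo_subset_Icc_self (hx j i)
  have hcU : c ∈ U := by
    intro j i
    have hj : (j : ℝ) + 1 ≤ N := by exact_mod_cast j.2
    fin_cases i
    · simp only [c, Fin.zero_eta, Matrix.cons_val_zero, Set.mem_Ioo]
      refine ⟨by positivity, ?_⟩
      rw [div_lt_one (by positivity)]
      linarith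
    · simp only [c, Fin.mk_one, Matrix.cons_val_one, Matrix.cons_val_fin_one,
        Set.mem_Ioo]
      norm_num
  obtain ⟨f, hfs, hfc, hf, hfr, hf1⟩ := exists_contDiff_tsupport_subset (n := ⊤)
    ((isClosed_fatDiagonal N).isOpen_compl.mem_nhds hcd)
  have hf0 : ∀ x, 0 ≤ f x := fun x => (hfr ⟨x, rfl⟩).1
  have hcore := isCore_sum_perm hf hfc hfs
  refine ⟨_, hcore, ?_⟩
  set φ := fun x : Config N => ((∑ σ : Equiv.Perm (Fin N), f fun j => x (σ j) : ℝ) : ℂ)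
  have hφc : φ c ≠ 0 := by
    rw [Complex.ofReal_ne_zero]
    -- Symmetrisation causes no cancellation: all terms are nonnegative and the identity contributes
    -- 1.
    refine ne_of_gt (lt_of_lt_of_le ?_
      (Finset.single_le_sum (fun σ _ => hf0 _) (Finset.mem_univ (1 : Equiv.Perm (Fin N)))))
    simp [hf1]
  rw [setIntegral_pos_iff_support_of_nonneg_ae (ae_of_all _ fun x => sq_nonneg _)
    hcore.integrable_norm_sq.integrableOn]
  have hV : IsOpen ({x | φ x ≠ 0} ∩ U) :=
    (isOpen_ne_fun hcore.continuous continuous_const).inter hUo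
  refine (hV.measure_pos volume ⟨c, hφc, hcU⟩).trans_le (measure_mono ?_)
  rintro x ⟨hx, hxU⟩
  exact ⟨by simpa using hx, hUs hxU⟩

/-- Needed because `sInf ∅ = 0` in `ℝ`: without it a core bound would not bound the infimum from
below. -/
theorem neumannEnergies_unitSquare_nonempty (N : ℕ) (α : ℝ) :
    (neumannEnergies N α unitSquare).Nonempty := by
  obtain ⟨φ, hφ, hM⟩ := exists_isCore_integral_pos N
  set M := ∫ x in domainPow N unitSquare, ‖φ x‖ ^ 2
  refine ⟨_, fun x => (((√M)⁻¹ : ℝ) : ℂ) * φ x, _, (hφ.const_mul _).isMagDeriv α, ?_, rfl⟩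
  simp only [norm_mul, mul_pow, Complex.norm_real, Real.norm_eq_abs, sq_abs, inv_pow,
    Real.sq_sqrt hM.le]
  rw [integral_const_mul, inv_mul_cancel₀ hM.ne']

theorem CoreBound.le_neumannEnergy {α c : ℝ} (h : CoreBound N α unitSquare c) :
    c ≤ neumannEnergy N α :=
  le_csInf (neumannEnergies_unitSquare_nonempty N α) fun _ he => h.le_of_mem_neumannEnergies he

/-! ### Scaling -/

/-- The closed square of side `1/2` with lower left corner `a`. -/
def halfBox (a : Plane) : Set Plane :=
  {x | ∀ i, x i ∈ Set.Icc (a i) (a i + 1 / 2)}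

theorem isClosed_halfBox (a : Plane) : IsClosed (halfBox a) := by
  simp only [halfBox, Set.ofPred_forall]
  exact isClosed_iInter fun i => isClosed_Icc.preimage (by fun_prop)

theorem isClosed_unitSquare : IsClosed unitSquare := by
  simp only [unitSquare, Set.ofPred_forall]
  exact isClosed_iInter fun i => isClosed_Icc.preimage (by fun_prop)

theorem measurableSet_domainPow {Ω : Set Plane} (h : MeasurableSet Ω) :
    MeasurableSet (domainPow N Ω) := by
  simp only [domainPow, Set.ofPred_forall]
  exact MeasurableSet.iInter fun j => measurable_pi_apply j h

theorem mem_halfBox_affine (a x : Plane) :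
    a + (1 / 2 : ℝ) • x ∈ halfBox a ↔ x ∈ unitSquare := by
  simp only [halfBox, unitSquare, Set.mem_ofPred_eq, Set.mem_Icc, PiLp.add_apply, PiLp.smul_apply,
    smul_eq_mul]
  refine forall_congr' fun i => ⟨fun h => ⟨?_, ?_⟩, fun h => ⟨?_, ?_⟩⟩ <;> linarith [h.1, h.2]

theorem setIntegral_halfBox (a : Plane) (f : Config N → ℝ) :
    ∫ x in domainPow N (halfBox a), f x =
      (1 / 2 : ℝ) ^ (Module.finrank ℝ (Config N)) *
        ∫ x in domainPow N unitSquare, f ((fun _ => a) + (1 / 2 : ℝ) • x) := by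
  rw [← integral_indicator (measurableSet_domainPow (isClosed_halfBox a).measurableSet),
    ← integral_indicator (measurableSet_domainPow isClosed_unitSquare.measurableSet)]
  set g := (domainPow N (halfBox a)).indicator f with hg
  have e : (domainPow N unitSquare).indicator (fun x => f ((fun _ => a) + (1 / 2 : ℝ) • x)) =
      fun x => g ((fun _ => a) + (1 / 2 : ℝ) • x) := by
    classical
    ext x
    simp only [hg, Set.indicator_apply]
    refine if_congr ?_ rfl rfl
    simp only [domainPow, Set.mem_ofPred_eq, Pi.add_apply, Pi.smul_apply, mem_halfBox_affine]
  rw [e, Measure.integral_comp_smul volume (fun y => g ((fun _ => a) + y)) (1 / 2 : ℝ),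
    integral_add_left_eq_self g]
  rw [smul_eq_mul, ← mul_assoc, abs_of_pos (by positivity), mul_inv_cancel₀ (by positivity),
    one_mul]

/-- A common translation leaves all differences unchanged, and the potential is homogeneous of
degree -1, so it scales like the gradient. -/
theorem magDeriv_comp_affine {φ : Config N → ℂ} (h : Differentiable ℝ φ) (α : ℝ)
    (b : Config N) (a : Plane) (hb : b = fun _ => a) {r : ℝ} (hr : r ≠ 0) (j : Fin N) (k : Fin 2)
    (x : Config N) :
    magDeriv α (fun x => φ (b + r • x)) j k x = r * magDeriv α φ j k (b + r • x) := by
  have hd : HasFDerivAt (fun x : Config N => b + r • x) (r • ContinuousLinearMap.id ℝ (Config N))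
      x := ((hasFDerivAt_id x).const_smul r).const_add b
  have h1 : fderiv ℝ (fun x => φ (b + r • x)) x =
      (fderiv ℝ φ (b + r • x)).comp (r • ContinuousLinearMap.id ℝ (Config N)) :=
    ((h _).hasFDerivAt.comp x hd).fderiv
  have h2 : vecPot j (b + r • x) k = r⁻¹ * vecPot j x k := by
    simp only [vecPot_apply', Finset.mul_sum]
    refine Finset.sum_congr rfl fun l _ => ?_
    rw [show (b + r • x) j - (b + r • x) l = r • (x j - x l) by
      simp [hb, smul_sub], perpInv_smul, PiLp.smul_apply, smul_eq_mul]
  simp only [magDeriv, partialDeriv, h1, h2]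
  simp only [ContinuousLinearMap.comp_apply, _root_.smul_apply, map_smul,
    ContinuousLinearMap.id_apply, Complex.real_smul]
  have : (r : ℂ) ≠ 0 := by exact_mod_cast hr
  push_cast
  field_simp

theorem IsCore.comp_affine {φ : Config N → ℂ} (h : IsCore φ) (a : Plane) {r : ℝ} (hr : r ≠ 0) :
    IsCore fun x => φ ((fun _ => a) + r • x) := by
  let e : Config N ≃ₜ Config N := (Homeomorph.smulOfNeZero r hr).trans
    (Homeomorph.addLeft (fun _ => a))
  have he : ∀ x, e x = (fun _ => a) + r • x := fun x => rfl
  have ht : tsupport (fun x => φ (e x)) = e ⁻¹' tsupport φ := tsupport_comp_eq_preimage φ e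
  refine ⟨?_, ?_, ?_, ?_⟩
  · exact h.smooth.comp (contDiff_const.add (contDiff_const_smul r))
  · exact h.compactSupport.comp_homeomorph e
  · change Disjoint (tsupport fun x => φ (e x)) _
    rw [ht, Set.disjoint_left]
    rintro x hx ⟨j, k, hjk, hxx⟩
    exact Set.disjoint_left.1 h.offDiagonal hx ⟨j, k, hjk, by simp [he, hxx]⟩
  · intro σ x
    exact h.symmetric σ ((fun _ => a) + r • x)

/-- Mass and energy acquire the same Jacobian; the energy also acquires (1/2)² from the derivatives,
whence the 4. -/
theorem CoreBound.halfBox {α c : ℝ} (h : CoreBound N α unitSquare c) (a : Plane) :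
    CoreBound N α (halfBox a) (4 * c) := by
  intro φ hφ
  have key := h _ (hφ.comp_affine a (r := 1 / 2) (by norm_num))
  rw [setIntegral_halfBox, setIntegral_halfBox]
  simp only [kinetic, magDeriv_comp_affine hφ.differentiable α _ a rfl
    (show (1 / 2 : ℝ) ≠ 0 by norm_num), norm_mul, mul_pow] at key
  simp only [← Finset.mul_sum] at key
  rw [integral_const_mul] at key
  have hn : ‖((1 / 2 : ℝ) : ℂ)‖ ^ 2 = 1 / 4 := by
    rw [Complex.norm_real]; norm_num
  rw [hn] at key
  have hp : (0 : ℝ) ≤ (1 / 2 : ℝ) ^ (Module.finrank ℝ (Config N)) := by positivity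
  have := mul_le_mul_of_nonneg_left key hp
  simp only [kinetic]
  linarith

/-! ### Gauge functions -/

theorem exists_contDiff_eventuallyEq_inv {ε : ℝ} (hε : 0 < ε) :
    ∃ h : ℝ → ℝ, ContDiff ℝ ∞ h ∧ ∀ u, ε ≤ |u| → h =ᶠ[𝓝 u] fun v => v⁻¹ := by
  -- The transition runs from 0 at t = ε²/4 to 1 at t = ε²/2. Then `m` interpolates between 1 and t
  -- without vanishing, and u / m(u²) is 1/u on a neighbourhood of |u| ≥ ε.
  let s : ℝ → ℝ := fun t => Real.smoothTransition (4 * t / ε ^ 2 - 1)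
  have hs : ContDiff ℝ ∞ s := Real.smoothTransition.contDiff.comp (by fun_prop)
  have hε2 : 0 < ε ^ 2 := by positivity
  let m : ℝ → ℝ := fun t => t * s t + (1 - s t)
  have hm : ContDiff ℝ ∞ m := (contDiff_id.mul hs).add (contDiff_const.sub hs)
  have hm0 : ∀ t, m t ≠ 0 := by
    intro t
    have h0 : 0 ≤ s t := Real.smoothTransition.nonneg _
    have h1 : s t ≤ 1 := Real.smoothTransition.le_one _
    rcases le_or_gt t (ε ^ 2 / 4) with ht | ht
    · have : s t = 0 := by
        refine Real.smoothTransition.zero_of_nonpos ?_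
        rw [sub_nonpos, div_le_one hε2]; linarith
      simp [m, this]
    · have ht0 : 0 < t := by linarith
      refine ne_of_gt ?_
      rcases h0.eq_or_lt with h | h
      · simp [m, ← h]
      · have := mul_pos ht0 h
        simp only [m]; linarith
  refine ⟨fun u => u * (m (u ^ 2))⁻¹,
    contDiff_id.mul ((hm.comp (contDiff_id.pow 2)).inv fun u => hm0 _), fun u hu => ?_⟩
  have hu2 : ε ^ 2 / 2 < u ^ 2 := by
    rw [← sq_abs u]
    nlinarith [abs_nonneg u]
  filter_upwards [(isOpen_lt continuous_const (continuous_pow 2)).mem_nhds hu2] with v hv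
  have hs1 : s (v ^ 2) = 1 := by
    refine Real.smoothTransition.one_of_one_le ?_
    rw [le_sub_iff_add_le, le_div_iff₀ hε2]
    have : ε ^ 2 / 2 < v ^ 2 := hv
    linarith
  have hv0 : v ≠ 0 := by
    rintro rfl
    have : ε ^ 2 / 2 < (0 : ℝ) ^ 2 := hv
    linarith
  simp only [m, hs1]
  field_simp
  ring

/-- The field is the gradient of the polar angle about p, an arctangent of a quotient of coordinates
wherever the denominator x_i - p_i does not vanish. Regularising the reciprocal makes the gauge
smooth on the whole plane, as multiplication of core functions requires. -/
theorem exists_gauge_of_separated {p : Plane} {Q : Set Plane} {ε : ℝ} (hε : 0 < ε) (i : Fin 2)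
    (hQ : ∀ x ∈ Q, ε ≤ |x i - p i|) :
    ∃ θ : Plane → ℝ, ContDiff ℝ ∞ θ ∧ ∀ x ∈ Q, ∀ k,
      fderiv ℝ θ x (EuclideanSpace.single k (1 : ℝ)) = perpInv (x - p) k := by
  obtain ⟨h, hh, hinv⟩ := exists_contDiff_eventuallyEq_inv hε
  have hcoord : ∀ l : Fin 2, ContDiff ℝ ∞ fun x : Plane => x l := fun l => by fun_prop
  have hd : ∀ (l : Fin 2) (x : Plane),
      HasFDerivAt (fun y : Plane => y l - p l) (EuclideanSpace.proj l : Plane →L[ℝ] ℝ) x :=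
    fun l x => (EuclideanSpace.proj l : Plane →L[ℝ] ℝ).hasFDerivAt.sub_const (p l)
  have hloc : ∀ x ∈ Q, ∀ l, (fun y : Plane => Real.arctan ((y l - p l) * h (y i - p i))) =ᶠ[𝓝 x]
      fun y => Real.arctan ((y l - p l) * (y i - p i)⁻¹) := by
    intro x hx l
    have ht : Tendsto (fun y : Plane => y i - p i) (𝓝 x) (𝓝 (x i - p i)) :=
      (hd i x).continuousAt
    filter_upwards [ht.eventually (hinv _ (hQ x hx))] with y hy
    rw [hy]
  have hder : ∀ x ∈ Q, ∀ l k,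
      fderiv ℝ (fun y : Plane => Real.arctan ((y l - p l) * h (y i - p i))) x
        (EuclideanSpace.single k (1 : ℝ)) =
      1 / (1 + ((x l - p l) * (x i - p i)⁻¹) ^ 2) *
        ((x l - p l) * (-((x i - p i) ^ 2)⁻¹ * (if i = k then 1 else 0)) +
          (x i - p i)⁻¹ * (if l = k then 1 else 0)) := by
    intro x hx l k
    have hne : x i - p i ≠ 0 := fun h0 => by
      have := hQ x hx
      rw [h0, abs_zero] at this
      linarith
    rw [(hloc x hx l).fderiv_eq]
    have e := ((hd l x).mul ((hasDerivAt_inv hne).comp_hasFDerivAt x (hd i x))).arctan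
    have e' := e.fderiv
    simp only [Function.comp_def] at e'
    rw [show (fun y : Plane => Real.arctan ((y l - p l) * (y i - p i)⁻¹)) =
      fun y : Plane => Real.arctan (((fun y : Plane => y l - p l) * fun y : Plane =>
        (y i - p i)⁻¹) y) from rfl, e']
    simp
    split_ifs <;> ring
  have hdiff : ∀ l, ContDiff ℝ ∞ fun y : Plane => Real.arctan ((y l - p l) * h (y i - p i)) :=
    fun l => Real.contDiff_arctan.comp
      (((hcoord l).sub contDiff_const).mul (hh.comp ((hcoord i).sub contDiff_const)))
  have hne : ∀ x ∈ Q, x i - p i ≠ 0 := fun x hx h0 => by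
    have := hQ x hx
    rw [h0, abs_zero] at this
    linarith
  fin_cases i
  · refine ⟨_, hdiff 1, fun x hx k => ?_⟩
    have h0 := hne x hx
    rw [hder x hx 1 k]
    have h2 : (x 0 - p 0) ^ 2 + (x 1 - p 1) ^ 2 ≠ 0 := by
      have := sq_pos_of_ne_zero h0
      simp only [Fin.zero_eta] at this
      positivity
    simp only [Fin.zero_eta] at h0 ⊢
    fin_cases k
    · simp [perpInv_apply_zero]
      field_simp
      ring
    · simp [perpInv_apply_one]
      field_simp
  -- With the vertical coordinate as denominator, the angle is minus the arctangent up to a local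
  -- constant.
  · refine ⟨_, (hdiff 0).neg, fun x hx k => ?_⟩
    have h0 := hne x hx
    rw [fderiv_fun_neg, _root_.neg_apply, hder x hx 0 k]
    have h2 : (x 0 - p 0) ^ 2 + (x 1 - p 1) ^ 2 ≠ 0 := by
      have := sq_pos_of_ne_zero h0
      simp only [Fin.mk_one] at this
      positivity
    simp only [Fin.mk_one] at h0 ⊢
    fin_cases k
    · simp [perpInv_apply_zero]
      field_simp
      ring
    · simp [perpInv_apply_one]
      field_simp
      ring

/-- A point outside a closed box is strictly separated from it in some coordinate; the gap is the ε.
-/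
theorem exists_gauge {a p : Plane} (hp : p ∉ halfBox a) :
    ∃ θ : Plane → ℝ, ContDiff ℝ ∞ θ ∧ ∀ x ∈ halfBox a, ∀ k,
      fderiv ℝ θ x (EuclideanSpace.single k (1 : ℝ)) = perpInv (x - p) k := by
  simp only [halfBox, Set.mem_ofPred_eq, not_forall, Set.mem_Icc, not_and_or, not_le] at hp
  obtain ⟨i, hi | hi⟩ := hp
  · refine exists_gauge_of_separated (sub_pos.2 hi) i fun x hx => ?_
    exact le_trans (by linarith [(hx i).1]) (le_abs_self _)
  · refine exists_gauge_of_separated (sub_pos.2 hi) i fun x hx => ?_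
    exact le_trans (by linarith [(hx i).2]) (neg_le_abs _)

/-! ### Slicing -/

variable {n m : ℕ}

/-- The configuration of `N` particles with positions `y` on `e ∘ inl` and `z` on `e ∘ inr`. -/
def glue (e : Fin n ⊕ Fin m ≃ Fin N) (y : Config n) (z : Config m) : Config N :=
  fun j => Sum.elim y z (e.symm j)

@[simp]
theorem glue_inl (e : Fin n ⊕ Fin m ≃ Fin N) (y : Config n) (z : Config m) (i : Fin n) :
    glue e y z (e (Sum.inl i)) = y i := by
  simp [glue]

@[simp]
theorem glue_inr (e : Fin n ⊕ Fin m ≃ Fin N) (y : Config n) (z : Config m) (l : Fin m) :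
    glue e y z (e (Sum.inr l)) = z l := by
  simp [glue]

theorem measurePreserving_glue (e : Fin n ⊕ Fin m ≃ Fin N) :
    MeasurePreserving (fun p : Config n × Config m => glue e p.1 p.2) (volume.prod volume)
      volume := by
  have h := (volume_measurePreserving_piCongrLeft (fun _ : Fin N => Plane) e).comp
    (volume_measurePreserving_sumPiEquivProdPi_symm (fun _ : Fin n ⊕ Fin m => Plane))
  have hf : (fun p : Config n × Config m => glue e p.1 p.2) =
      MeasurableEquiv.piCongrLeft (fun _ : Fin N => Plane) e ∘
        (MeasurableEquiv.sumPiEquivProdPi fun _ : Fin n ⊕ Fin m => Plane).symm := by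
    refine funext fun p => funext fun j => ?_
    obtain ⟨j, rfl⟩ := e.surjective j
    rw [Function.comp_apply, MeasurableEquiv.coe_piCongrLeft, Equiv.piCongrLeft_apply_apply]
    cases j <;> simp <;> rfl
  rw [hf]
  exact h

theorem measurableEmbedding_glue (e : Fin n ⊕ Fin m ≃ Fin N) :
    MeasurableEmbedding (fun p : Config n × Config m => glue e p.1 p.2) := by
  let E : (Config n × Config m) ≃ᵐ Config N :=
    { toFun := fun p => glue e p.1 p.2
      invFun := fun x => (fun i => x (e (Sum.inl i)), fun l => x (e (Sum.inr l)))
      left_inv := fun p => by simp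
      right_inv := fun x => by
        ext j : 1
        obtain ⟨j, rfl⟩ := e.surjective j
        cases j <;> simp
      measurable_toFun := (measurePreserving_glue e).measurable
      measurable_invFun := by
        refine Measurable.prodMk ?_ ?_ <;>
          exact measurable_pi_lambda _ fun i => measurable_pi_apply _ }
  exact E.measurableEmbedding

theorem exists_linear_glue (e : Fin n ⊕ Fin m ≃ Fin N) (z : Config m) :
    ∃ L : Config n →L[ℝ] Config N, (∀ i v, L (Pi.single i v) = Pi.single (e (Sum.inl i)) v) ∧
      ∀ y, glue e y z = L y + glue e 0 z := by
  refine ⟨ContinuousLinearMap.pi fun j => Sum.elim (fun i => ContinuousLinearMap.proj i)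
    (fun _ => 0) (e.symm j), fun i v => ?_, fun y => ?_⟩
  · ext j : 1
    obtain ⟨j, rfl⟩ := e.surjective j
    rcases j with j | j
    · by_cases h : j = i
      · subst h; simp
      · have h' : e (Sum.inl j) ≠ e (Sum.inl i) := fun h' => h (by simpa using h')
        simp [h, h']
    · have h' : e (Sum.inr j) ≠ e (Sum.inl i) := fun h' => by simp at h'
      simp [h']
  · ext j : 1
    obtain ⟨j, rfl⟩ := e.surjective j
    cases j <;> simp

theorem contDiff_glue (e : Fin n ⊕ Fin m ≃ Fin N) (z : Config m) :
    ContDiff ℝ ∞ fun y => glue e y z := by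
  obtain ⟨L, -, h⟩ := exists_linear_glue e z
  rw [funext h]
  exact L.contDiff.add contDiff_const

theorem partialDeriv_comp_glue {Φ : Config N → ℂ} (hΦ : Differentiable ℝ Φ)
    (e : Fin n ⊕ Fin m ≃ Fin N) (z : Config m) (i : Fin n) (k : Fin 2) (y : Config n) :
    partialDeriv (fun y => Φ (glue e y z)) i k y =
      partialDeriv Φ (e (Sum.inl i)) k (glue e y z) := by
  obtain ⟨L, hL, h⟩ := exists_linear_glue e z
  have hd : HasFDerivAt (fun y => glue e y z) L y := by
    rw [funext h]
    exact L.hasFDerivAt.add_const _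
  have := ((hΦ (glue e y z)).hasFDerivAt.comp y hd).fderiv
  simp only [Function.comp_def] at this
  rw [partialDeriv, this, ContinuousLinearMap.comp_apply, hL, partialDeriv]

/-- The potential splits into the interaction of the moving particles and the field of the frozen
ones. -/
theorem vecPot_glue_apply (e : Fin n ⊕ Fin m ≃ Fin N) (y : Config n) (z : Config m) (i : Fin n)
    (k : Fin 2) : vecPot (e (Sum.inl i)) (glue e y z) k =
      vecPot i y k + ∑ l, perpInv (y i - z l) k := by
  simp only [vecPot_apply']
  rw [← e.sum_comp, Fintype.sum_sum_type]
  simp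

theorem isCore_phase_mul_glue {Φ : Config N → ℂ} (hΦ : IsCore Φ) (e : Fin n ⊕ Fin m ≃ Fin N)
    (z : Config m) {θ : Plane → ℝ} (hθ : ContDiff ℝ ∞ θ) :
    IsCore fun y : Config n => Complex.exp (Complex.I * ((∑ i, θ (y i) : ℝ) : ℂ)) *
      Φ (glue e y z) := by
  have hc : HasCompactSupport fun y => Φ (glue e y z) := by
    refine HasCompactSupport.intro (K := (fun (x : Config N) i => x (e (Sum.inl i))) '' tsupport Φ)
      (hΦ.compactSupport.isCompact.image (by fun_prop)) fun y hy => ?_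
    refine image_eq_zero_of_notMem_tsupport fun h => hy ⟨_, h, ?_⟩
    simp
  refine ⟨?_, hc.mul_left, ?_, ?_⟩
  · have hs : ContDiff ℝ ∞ fun y : Config n => ∑ i, θ (y i) :=
      ContDiff.sum fun i _ => hθ.comp (contDiff_apply ℝ Plane i)
    exact ContDiff.mul (ContDiff.cexp (contDiff_const.mul (Complex.ofRealCLM.contDiff.comp hs)))
      (hΦ.smooth.comp (contDiff_glue e z))
  · refine Disjoint.mono_left (tsupport_mul_subset_right (g := fun y => Φ (glue e y z))) ?_
    rw [Set.disjoint_left]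
    rintro y hy ⟨i, k, hik, h⟩
    have hy' : glue e y z ∈ tsupport Φ :=
      tsupport_comp_subset_preimage Φ (contDiff_glue e z).continuous hy
    exact Set.disjoint_left.1 hΦ.offDiagonal hy'
      ⟨e (Sum.inl i), e (Sum.inl k), by simpa using hik, by simpa using h⟩
  · intro σ y
    have h1 : ∑ i, θ (y (σ i)) = ∑ i, θ (y i) := Equiv.sum_comp σ fun i => θ (y i)
    -- The permutation of the moving particles is extended by the identity on the frozen ones.
    have h2 := hΦ.symmetric ((e.symm.trans (Equiv.sumCongr σ (Equiv.refl _))).trans e)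
      (glue e y z)
    rw [h1, ← h2]
    congr 2
    ext j : 1
    obtain ⟨j, rfl⟩ := e.surjective j
    cases j <;> simp

/-- Differentiating the phase adds ∇θ to the operator, and this supplies exactly the field of the
frozen particles missing from the n-particle potential. -/
theorem magDeriv_phase_mul_glue {Φ : Config N → ℂ} (hΦ : IsCore Φ) (e : Fin n ⊕ Fin m ≃ Fin N)
    (z : Config m) (α : ℝ) {θ : Plane → ℝ} (hθ : ContDiff ℝ ∞ θ) (i : Fin n) (k : Fin 2)
    (y : Config n) (h : fderiv ℝ θ (y i) (EuclideanSpace.single k (1 : ℝ)) =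
      α * ∑ l, perpInv (y i - z l) k) :
    magDeriv α (fun y => Complex.exp (Complex.I * ((∑ i, θ (y i) : ℝ) : ℂ)) * Φ (glue e y z))
      i k y = Complex.exp (Complex.I * ((∑ i, θ (y i) : ℝ) : ℂ)) *
        magDeriv α Φ (e (Sum.inl i)) k (glue e y z) := by
  have hS : HasFDerivAt (fun y : Config n => ∑ i, θ (y i))
      (∑ i, (fderiv ℝ θ (y i)).comp (ContinuousLinearMap.proj i)) y :=
    HasFDerivAt.fun_sum fun i _ => HasFDerivAt.comp y
      ((hθ.differentiable (by simp)) (y i)).hasFDerivAt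
      (ContinuousLinearMap.proj (R := ℝ) (φ := fun _ : Fin n => Plane) i).hasFDerivAt
  have hE := ((Complex.ofRealCLM.hasFDerivAt.comp y hS).const_mul Complex.I).cexp
  have hG : DifferentiableAt ℝ (fun y => Φ (glue e y z)) y :=
    (hΦ.smooth.comp (contDiff_glue e z)).differentiable (by simp) y
  have hP := (hE.mul hG.hasFDerivAt).fderiv
  have hsum : (∑ l, (fderiv ℝ θ (y l)).comp (ContinuousLinearMap.proj (R := ℝ)
      (φ := fun _ : Fin n => Plane) l)) (Pi.single i (EuclideanSpace.single k (1 : ℝ))) =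
      α * ∑ l, perpInv (y i - z l) k := by
    rw [_root_.sum_apply, Finset.sum_eq_single i]
    · simp [h]
    · intro l _ hl
      simp [hl]
    · simp
  have hp : partialDeriv (fun y => Complex.exp (Complex.I * ((∑ i, θ (y i) : ℝ) : ℂ)) *
      Φ (glue e y z)) i k y = Complex.exp (Complex.I * ((∑ i, θ (y i) : ℝ) : ℂ)) *
        (partialDeriv Φ (e (Sum.inl i)) k (glue e y z) +
          Complex.I * ((α * ∑ l, perpInv (y i - z l) k : ℝ) : ℂ) * Φ (glue e y z)) := by
    rw [← partialDeriv_comp_glue hΦ.differentiable, partialDeriv]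
    refine (congrArg (fun L => L (Pi.single i (EuclideanSpace.single k (1 : ℝ)))) hP).trans ?_
    simp only [_root_.add_apply, _root_.smul_apply, ContinuousLinearMap.comp_apply, hsum,
      Function.comp_apply, Complex.ofRealCLM_apply, smul_eq_mul, partialDeriv]
    ring
  rw [magDeriv, hp, magDeriv, vecPot_glue_apply]
  push_cast
  linear_combination (-Complex.exp (Complex.I * ∑ i, (θ (y i) : ℂ)) *
    (α * ∑ l, (perpInv (y i - z l) k : ℂ)) * Φ (glue e y z)) * Complex.I_sq

theorem CoreBound.slice {α c : ℝ} {a : Plane} (h : CoreBound n α (Anyon.halfBox a) c)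
    {Φ : Config N → ℂ} (hΦ : IsCore Φ) (e : Fin n ⊕ Fin m ≃ Fin N) {z : Config m}
    (hz : ∀ l, z l ∉ Anyon.halfBox a) :
    c * ∫ y in domainPow n (Anyon.halfBox a), ‖Φ (glue e y z)‖ ^ 2 ≤
      ∫ y in domainPow n (Anyon.halfBox a), ∑ i, kinetic α Φ (e (Sum.inl i)) (glue e y z) := by
  choose θ hθ hder using fun l => exists_gauge (hz l)
  have hs : ContDiff ℝ ∞ fun x => α * ∑ l, θ l x :=
    contDiff_const.mul (ContDiff.sum fun l _ => hθ l)
  have hsd : ∀ x ∈ Anyon.halfBox a, ∀ k, fderiv ℝ (fun x => α * ∑ l, θ l x) x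
      (EuclideanSpace.single k (1 : ℝ)) = α * ∑ l, perpInv (x - z l) k := by
    intro x hx k
    have hd := ((HasFDerivAt.fun_sum (u := Finset.univ) fun l _ =>
      ((hθ l).differentiable (by simp) x).hasFDerivAt).const_mul α).fderiv
    rw [hd]
    simp [hder _ x hx]
  have key := h _ (isCore_phase_mul_glue hΦ e z hs)
  have hn : ∀ t : ℝ, ‖Complex.exp (Complex.I * (t : ℂ))‖ = 1 := fun t => by
    rw [mul_comm, Complex.norm_exp_ofReal_mul_I]
  simp only [norm_mul, hn, one_mul] at key
  refine key.trans_eq (setIntegral_congr_fun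
    (measurableSet_domainPow (isClosed_halfBox a).measurableSet) fun y hy => ?_)
  simp only [kinetic]
  refine Finset.sum_congr rfl fun i _ => Finset.sum_congr rfl fun k _ => ?_
  rw [magDeriv_phase_mul_glue hΦ e z α hs i k y (hsd _ (hy i) k), norm_mul, hn, one_mul]

/-- Fubini: R is a product in glued coordinates, and the slice bound holds for every frozen
configuration in V. -/
theorem CoreBound.integral_slices {α c : ℝ} {a : Plane}
    (h : CoreBound n α (Anyon.halfBox a) c) {Φ : Config N → ℂ} (hΦ : IsCore Φ)
    (e : Fin n ⊕ Fin m ≃ Fin N) {V : Set Plane} (hV : MeasurableSet V)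
    (hVa : Disjoint V (Anyon.halfBox a)) {R : Set (Config N)}
    (hR : ∀ x, x ∈ R ↔ (∀ i, x (e (Sum.inl i)) ∈ Anyon.halfBox a) ∧
      ∀ l, x (e (Sum.inr l)) ∈ V) :
    c * ∫ x in R, ‖Φ x‖ ^ 2 ≤ ∫ x in R, ∑ i, kinetic α Φ (e (Sum.inl i)) x := by
  have hpre : (fun p : Config n × Config m => glue e p.1 p.2) ⁻¹' R =
      domainPow n (Anyon.halfBox a) ×ˢ domainPow m V := by
    ext p
    simp [hR, domainPow]
  have hmeas := measurePreserving_glue e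
  have hemb := measurableEmbedding_glue e
  have hQm := measurableSet_domainPow (N := n) (isClosed_halfBox a).measurableSet
  have hVm := measurableSet_domainPow (N := m) hV
  have i1 : Integrable (fun p : Config n × Config m => ‖Φ (glue e p.1 p.2)‖ ^ 2)
      ((volume.restrict (domainPow n (Anyon.halfBox a))).prod
        (volume.restrict (domainPow m V))) := by
    rw [Measure.prod_restrict]
    exact ((hmeas.integrable_comp_emb hemb).2 hΦ.integrable_norm_sq).restrict
  have i2 : Integrable (fun p : Config n × Config m =>
      ∑ i, kinetic α Φ (e (Sum.inl i)) (glue e p.1 p.2))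
      ((volume.restrict (domainPow n (Anyon.halfBox a))).prod
        (volume.restrict (domainPow m V))) := by
    rw [Measure.prod_restrict]
    exact ((hmeas.integrable_comp_emb hemb).2 (integrable_finsetSum _ fun i _ =>
      hΦ.integrable_kinetic α (e (Sum.inl i)))).restrict
  rw [← hmeas.setIntegral_preimage_emb hemb, ← hmeas.setIntegral_preimage_emb hemb, hpre,
    ← Measure.prod_restrict, integral_prod_symm _ i1, integral_prod_symm _ i2,
    ← integral_const_mul]
  refine setIntegral_mono_on (i1.integral_prod_right.const_mul c) i2.integral_prod_right hVm
    fun z hz => ?_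
  exact h.slice hΦ e fun l => Set.disjoint_left.1 hVa (hz l)

/-! ### Partition of the unit square into quadrants -/

/-- The lower left corner of a quadrant of the unit square. -/
noncomputable def corner (q : Bool × Bool) : Plane :=
  !₂[if q.1 then 1 / 2 else 0, if q.2 then 1 / 2 else 0]

/-- A closed quadrant of the unit square. -/
noncomputable abbrev quadrant (q : Bool × Bool) : Set Plane := halfBox (corner q)

theorem mem_quadrant {q : Bool × Bool} {p : Plane} :
    p ∈ quadrant q ↔
      p 0 ∈ Set.Icc (if q.1 then 1 / 2 else (0 : ℝ)) ((if q.1 then 1 / 2 else 0) + 1 / 2) ∧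
      p 1 ∈ Set.Icc (if q.2 then 1 / 2 else (0 : ℝ)) ((if q.2 then 1 / 2 else 0) + 1 / 2) := by
  simp [quadrant, halfBox, corner, Fin.forall_fin_two]

theorem mem_unitSquare {p : Plane} :
    p ∈ unitSquare ↔ p 0 ∈ Set.Icc (0 : ℝ) 1 ∧ p 1 ∈ Set.Icc (0 : ℝ) 1 := by
  simp [unitSquare, Fin.forall_fin_two]

theorem quadrant_subset_unitSquare (q : Bool × Bool) : quadrant q ⊆ unitSquare := by
  intro p hp
  rw [mem_quadrant] at hp
  rw [mem_unitSquare]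
  obtain ⟨⟨h1, h2⟩, h3, h4⟩ := hp
  refine ⟨⟨?_, ?_⟩, ?_, ?_⟩ <;> split_ifs at * <;> linarith

/-- Closed quadrants overlap only on the two midlines, which are negligible by `ae_coord_ne`. -/
theorem existsUnique_mem_quadrant {p : Plane} (hp : p ∈ unitSquare) (h : ∀ i, p i ≠ 1 / 2) :
    ∃! q, p ∈ quadrant q := by
  rw [mem_unitSquare] at hp
  obtain ⟨⟨h1, h2⟩, h3, h4⟩ := hp
  have key : ∀ t : ℝ, 0 ≤ t → t ≤ 1 → t ≠ 1 / 2 → ∀ b : Bool,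
      t ∈ Set.Icc (if b then 1 / 2 else (0 : ℝ)) ((if b then 1 / 2 else 0) + 1 / 2) ↔
        b = decide (1 / 2 < t) := by
    intro t h0 h1 ht b
    rcases lt_or_gt_of_ne ht with h | h
    · have : ¬ (1 / 2 < t) := not_lt.2 h.le
      cases b <;> simp only [Set.mem_Icc, this, decide_false] <;> simp <;>
        first | linarith | (constructor <;> linarith) | (intros; linarith)
    · cases b <;> simp only [Set.mem_Icc, h, decide_true] <;> simp <;>
        first | linarith | (constructor <;> linarith) | (intros; linarith)
  refine ⟨(decide (1 / 2 < p 0), decide (1 / 2 < p 1)), ?_, fun q hq => ?_⟩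
  · simp only [mem_quadrant, key _ h1 h2 (h 0), key _ h3 h4 (h 1), and_self]
  · simp only [mem_quadrant, key _ h1 h2 (h 0), key _ h3 h4 (h 1)] at hq
    exact Prod.ext hq.1 hq.2

theorem ae_coord_ne (c : ℝ) : ∀ᵐ x : Config N, ∀ j i, x j i ≠ c := by
  rw [ae_all_iff]
  intro j
  rw [ae_all_iff]
  intro i
  have h1 : ∀ᵐ t : ℝ, t ≠ c := Measure.ae_ne volume c
  have h2 : ∀ᵐ p : Fin 2 → ℝ, p i ≠ c :=
    (Measure.quasiMeasurePreserving_eval (fun _ : Fin 2 => (volume : Measure ℝ)) i).ae h1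
  have h3 : ∀ᵐ p : Plane, p i ≠ c :=
    (PiLp.volume_preserving_ofLp (Fin 2)).quasiMeasurePreserving.ae h2
  exact (Measure.quasiMeasurePreserving_eval (fun _ : Fin N => (volume : Measure Plane)) j).ae h3

open Classical in
/-- The set of particles in the quadrant `q`. -/
noncomputable def occupants (q : Bool × Bool) (x : Config N) : Finset (Fin N) :=
  Finset.univ.filter fun j => x j ∈ quadrant q

@[simp]
theorem mem_occupants {q : Bool × Bool} {x : Config N} {j : Fin N} :
    j ∈ occupants q x ↔ x j ∈ quadrant q := by
  simp [occupants]

theorem sum_occupants {x : Config N} (hx : x ∈ domainPow N unitSquare)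
    (h : ∀ j i, x j i ≠ 1 / 2) {M : Type*} [AddCommMonoid M] (f : Fin N → M) :
    ∑ q, ∑ j ∈ occupants q x, f j = ∑ j, f j := by
  classical
  have : ∀ q, ∑ j ∈ occupants q x, f j = ∑ j, if x j ∈ quadrant q then f j else 0 := by
    intro q
    rw [occupants, Finset.sum_filter]
  simp only [this]
  rw [Finset.sum_comm]
  refine Finset.sum_congr rfl fun j _ => ?_
  obtain ⟨q, hq, hu⟩ := existsUnique_mem_quadrant (hx j) (h j)
  rw [Finset.sum_eq_single q (fun q' _ hne => if_neg fun h' => hne (hu q' h')) (by simp)]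
  exact if_pos hq

theorem measurableSet_occupants_eq (q : Bool × Bool) (S : Finset (Fin N)) :
    MeasurableSet {x : Config N | occupants q x = S} := by
  have : {x : Config N | occupants q x = S} = ⋂ j, {x | x j ∈ quadrant q ↔ j ∈ S} := by
    ext x
    simp [Finset.ext_iff]
  rw [this]
  refine MeasurableSet.iInter fun j => ?_
  have hm : MeasurableSet {x : Config N | x j ∈ quadrant q} :=
    measurable_pi_apply j (isClosed_halfBox _).measurableSet
  by_cases hj : j ∈ S
  · simpa [hj] using hm
  · simp only [hj, iff_false]
    exact hm.compl

/-! ### Integrands selected by a finite-valued map -/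

section Fiberwise

theorem eq_sum_indicator_fiber {X ι : Type*} [Fintype ι] (o : X → ι) (g : ι → X → ℝ) :
    (fun x => g (o x) x) = fun x => ∑ s, {x | o x = s}.indicator (g s) x := by
  classical
  ext x
  rw [Finset.sum_eq_single (o x)]
  · simp
  · intro s _ hs
    exact Set.indicator_of_notMem (s := {x | o x = s}) (fun h : o x = s => hs h.symm) (g s)
  · simp

variable {X ι : Type*} [MeasurableSpace X] {μ : Measure X} [Fintype ι] {o : X → ι}
  {g : ι → X → ℝ}

theorem integrable_fiberwise (ho : ∀ s, MeasurableSet {x | o x = s})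
    (hg : ∀ s, Integrable (g s) μ) : Integrable (fun x => g (o x) x) μ := by
  rw [eq_sum_indicator_fiber]
  exact integrable_finsetSum _ fun s _ => (hg s).indicator (ho s)

theorem setIntegral_fiberwise (ho : ∀ s, MeasurableSet {x | o x = s})
    (hg : ∀ s, Integrable (g s) μ) (U : Set X) :
    ∫ x in U, g (o x) x ∂μ = ∑ s, ∫ x in {x | o x = s} ∩ U, g s x ∂μ := by
  rw [eq_sum_indicator_fiber,
    integral_finsetSum _ fun s _ => ((hg s).indicator (ho s)).integrableOn]
  refine Finset.sum_congr rfl fun s _ => ?_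
  rw [integral_indicator (ho s), Measure.restrict_restrict (ho s)]

end Fiberwise

/-! ### Superadditivity over the quadrants -/

theorem CoreBound.setIntegral_occupants_eq {α c : ℝ} {Φ : Config N → ℂ} (hΦ : IsCore Φ)
    (q : Bool × Bool) (S : Finset (Fin N)) (h : CoreBound S.card α unitSquare c) :
    ∫ x in {x | occupants q x = S} ∩ domainPow N unitSquare, 4 * c * ‖Φ x‖ ^ 2 ≤
      ∫ x in {x | occupants q x = S} ∩ domainPow N unitSquare, ∑ j ∈ S, kinetic α Φ j x := by
  classical
  let e : Fin S.card ⊕ Fin Sᶜ.card ≃ Fin N := finSumEquivOfFinset rfl rfl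
  have el : ∀ i, e (Sum.inl i) ∈ S := fun i => by simp [e]
  have er : ∀ l, e (Sum.inr l) ∉ S := fun l => by
    rw [← Finset.mem_compl]
    simp only [e, finSumEquivOfFinset_inr]
    exact Finset.orderEmbOfFin_mem _ _ _
  have hsum : ∀ x, ∑ j ∈ S, kinetic α Φ j x = ∑ i, kinetic α Φ (e (Sum.inl i)) x := by
    intro x
    rw [← Finset.sum_ite_mem_eq S, ← e.sum_comp, Fintype.sum_sum_type]
    simp [el, er]
  simp only [hsum]
  rw [integral_const_mul]
  -- The frozen particles range over the unit square minus the closed quadrant.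
  refine (h.halfBox (corner q)).integral_slices hΦ e
    (isClosed_unitSquare.measurableSet.diff (isClosed_halfBox (corner q)).measurableSet)
    Set.disjoint_sdiff_left fun x => ?_
  have hocc : occupants q x = S ↔ (∀ i, x (e (Sum.inl i)) ∈ quadrant q) ∧
      ∀ l, x (e (Sum.inr l)) ∉ quadrant q := by
    rw [Finset.ext_iff, ← e.forall_congr_right, Sum.forall]
    simp [el, er]
  have hU : x ∈ domainPow N unitSquare ↔ (∀ i, x (e (Sum.inl i)) ∈ unitSquare) ∧
      ∀ l, x (e (Sum.inr l)) ∈ unitSquare := by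
    rw [domainPow, Set.mem_ofPred_eq, ← e.forall_congr_right, Sum.forall]
  rw [Set.mem_inter_iff, Set.mem_ofPred_eq, hocc, hU]
  constructor
  · rintro ⟨⟨h1, h2⟩, -, h4⟩
    exact ⟨h1, fun l => ⟨h4 l, h2 l⟩⟩
  · rintro ⟨h1, h2⟩
    exact ⟨⟨h1, fun l => (h2 l).2⟩, fun i => quadrant_subset_unitSquare q (h1 i),
      fun l => (h2 l).1⟩

theorem integrable_occupants_mass {Φ : Config N → ℂ} (hΦ : IsCore Φ) (b : ℕ → ℝ) :
    Integrable fun x => (∑ q, 4 * b (occupants q x).card) * ‖Φ x‖ ^ 2 := by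
  simp only [Finset.sum_mul]
  exact integrable_finsetSum _ fun q _ =>
    integrable_fiberwise (g := fun S x => 4 * b S.card * ‖Φ x‖ ^ 2)
      (measurableSet_occupants_eq q) fun S => hΦ.integrable_norm_sq.const_mul _

/-- Superadditivity of the energy with respect to the partition into quadrants. -/
theorem setIntegral_occupants_le {α : ℝ} {b : ℕ → ℝ}
    (hb : ∀ n ≤ N, CoreBound n α unitSquare (b n)) {Φ : Config N → ℂ} (hΦ : IsCore Φ) :
    ∫ x in domainPow N unitSquare, (∑ q, 4 * b (occupants q x).card) * ‖Φ x‖ ^ 2 ≤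
      ∫ x in domainPow N unitSquare, ∑ j, kinetic α Φ j x := by
  have hU := measurableSet_domainPow (N := N) isClosed_unitSquare.measurableSet
  have i1 : ∀ S : Finset (Fin N), Integrable fun x => 4 * b S.card * ‖Φ x‖ ^ 2 := fun S =>
    hΦ.integrable_norm_sq.const_mul _
  have i2 : ∀ S : Finset (Fin N), Integrable fun x => ∑ j ∈ S, kinetic α Φ j x := fun S =>
    integrable_finsetSum _ fun j _ => hΦ.integrable_kinetic α j
  have hR : ∫ x in domainPow N unitSquare, ∑ j, kinetic α Φ j x =
      ∫ x in domainPow N unitSquare, ∑ q, ∑ j ∈ occupants q x, kinetic α Φ j x := by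
    refine setIntegral_congr_ae hU ?_
    filter_upwards [ae_coord_ne (N := N) (1 / 2)] with x hx hxU
    exact (sum_occupants hxU hx _).symm
  have j1 : ∀ q, Integrable fun x : Config N =>
      4 * b (occupants q x).card * ‖Φ x‖ ^ 2 := fun q => integrable_fiberwise
    (g := fun S x => 4 * b S.card * ‖Φ x‖ ^ 2) (measurableSet_occupants_eq q) i1
  have j2 : ∀ q, Integrable fun x : Config N => ∑ j ∈ occupants q x, kinetic α Φ j x := fun q =>
    integrable_fiberwise (g := fun S x => ∑ j ∈ S, kinetic α Φ j x)
      (measurableSet_occupants_eq q) i2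
  simp only [hR, Finset.sum_mul]
  rw [integral_finsetSum _ fun q _ => (j1 q).integrableOn,
    integral_finsetSum _ fun q _ => (j2 q).integrableOn]
  refine Finset.sum_le_sum fun q _ => ?_
  rw [setIntegral_fiberwise (g := fun S x => 4 * b S.card * ‖Φ x‖ ^ 2)
      (measurableSet_occupants_eq q) i1,
    setIntegral_fiberwise (g := fun S x => ∑ j ∈ S, kinetic α Φ j x)
      (measurableSet_occupants_eq q) i2]
  refine Finset.sum_le_sum fun S _ => CoreBound.setIntegral_occupants_eq hΦ q S (hb _ ?_)
  simpa using S.card_le_univ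

/-! ### Transport of mass along translations -/

theorem setIntegral_comp_add_right_le {E : Type*} [MeasurableSpace E] [AddGroup E]
    [MeasurableAdd₂ E] {μ : Measure E} [μ.IsAddRightInvariant] {g : E → ℝ} (hg : Integrable g μ)
    {K U : Set E} (hK : MeasurableSet K) (hU : MeasurableSet U) (hg0 : ∀ y ∈ U, 0 ≤ g y) (v : E)
    (hKU : ∀ x ∈ K, x + v ∈ U) : ∫ x in K, g (x + v) ∂μ ≤ ∫ x in U, g x ∂μ := by
  rw [← integral_indicator hK, ← integral_indicator hU,
    ← integral_add_right_eq_self (U.indicator g) v]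
  refine integral_mono ((hg.comp_add_right v).indicator hK)
    ((hg.indicator hU).comp_add_right v) fun x => ?_
  by_cases hx : x ∈ K
  · simp [hx, hKU x hx]
  · rw [Set.indicator_of_notMem hx]
    exact Set.indicator_nonneg hg0 _

/-- Integrate the derivative along the segment from x to x + v and exchange the integrals. At each
time t the translate of K stays in U, so translation invariance bounds the inner integral by that of
g over U. -/
theorem setIntegral_le_setIntegral_comp_add {E : Type*} [NormedAddCommGroup E] [NormedSpace ℝ E]
    [MeasurableSpace E] [BorelSpace E] [SecondCountableTopology E] {μ : Measure E}
    [SFinite μ] [IsFiniteMeasureOnCompacts μ] [μ.IsAddRightInvariant] {f : E → ℝ}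
    (hf : ContDiff ℝ 1 f) (v : E)
    {g : E → ℝ} (hg : Continuous g) (hgi : Integrable g μ) (hfg : ∀ x, |fderiv ℝ f x v| ≤ g x)
    {K U : Set E} (hK : IsCompact K) (hU : MeasurableSet U)
    (hKU : ∀ x ∈ K, ∀ t ∈ Set.Icc (0 : ℝ) 1, x + t • v ∈ U) :
    ∫ x in K, f x ∂μ ≤ (∫ x in K, f (x + v) ∂μ) + ∫ x in U, g x ∂μ := by
  have hg0 : ∀ x, 0 ≤ g x := fun x => (abs_nonneg _).trans (hfg x)
  have hcont : Continuous fun p : E × ℝ => g (p.1 + p.2 • v) := by fun_prop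
  have hint : Integrable (Function.uncurry fun (x : E) (t : ℝ) => g (x + t • v))
      ((μ.restrict K).prod (volume.restrict (Set.Icc (0 : ℝ) 1))) := by
    rw [Measure.prod_restrict]
    exact hcont.continuousOn.integrableOn_compact (hK.prod isCompact_Icc)
  have hpt : ∀ x, f x - f (x + v) ≤ ∫ t in Set.Icc (0 : ℝ) 1, g (x + t • v) := by
    intro x
    have hder : ∀ t : ℝ, HasDerivAt (fun t : ℝ => f (x + t • v)) (fderiv ℝ f (x + t • v) v) t := by
      intro t
      have h1 : HasDerivAt (fun t : ℝ => x + t • v) v t := by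
        simpa using ((hasDerivAt_id t).smul_const v).const_add x
      exact ((hf.differentiable (by simp)) _).hasFDerivAt.comp_hasDerivAt t h1
    have hc : Continuous fun t : ℝ => fderiv ℝ f (x + t • v) v :=
      ((hf.continuous_fderiv (by simp)).comp (by fun_prop)).clm_apply continuous_const
    have hFTC := intervalIntegral.integral_eq_sub_of_hasDerivAt (a := 0) (b := 1)
      (fun t _ => hder t) (hc.intervalIntegrable _ _)
    have hle : |∫ t in (0 : ℝ)..1, fderiv ℝ f (x + t • v) v| ≤
        ∫ t in (0 : ℝ)..1, g (x + t • v) :=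
      (intervalIntegral.abs_integral_le_integral_abs zero_le_one).trans
        (intervalIntegral.integral_mono_on zero_le_one (hc.abs.intervalIntegrable _ _)
          ((by fun_prop : Continuous fun t : ℝ => g (x + t • v)).intervalIntegrable _ _)
          fun t _ => hfg _)
    rw [integral_Icc_eq_integral_Ioc, ← intervalIntegral.integral_of_le zero_le_one]
    rw [hFTC] at hle
    simp only [one_smul, zero_smul, add_zero] at hle
    linarith [neg_le_abs (f (x + v) - f x)]
  have hfc : Continuous f := hf.continuous
  have if1 : IntegrableOn f K μ := hfc.continuousOn.integrableOn_compact hK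
  have if2 : IntegrableOn (fun x => f (x + v)) K μ :=
    (by fun_prop : Continuous fun x => f (x + v)).continuousOn.integrableOn_compact hK
  rw [← sub_le_iff_le_add', ← integral_sub if1 if2]
  calc ∫ x in K, (f x - f (x + v)) ∂μ
      ≤ ∫ x in K, (∫ t in Set.Icc (0 : ℝ) 1, g (x + t • v)) ∂μ :=
        integral_mono (if1.sub if2) hint.integral_prod_left hpt
    _ = ∫ t in Set.Icc (0 : ℝ) 1, (∫ x in K, g (x + t • v) ∂μ) := integral_integral_swap hint
    _ ≤ ∫ t in Set.Icc (0 : ℝ) 1, (∫ x in U, g x ∂μ) := by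
        refine setIntegral_mono_on hint.integral_prod_right (integrable_const _)
          measurableSet_Icc fun t ht => ?_
        exact setIntegral_comp_add_right_le hgi hK.measurableSet hU (fun y _ => hg0 y) _
          fun x hx => hKU x hx t ht
    _ = ∫ x in U, g x ∂μ := by simp

/-- Diamagnetic inequality: the potential is real, so it drops out of the real part giving the
derivative of |Φ|². -/
theorem IsCore.abs_fderiv_norm_sq_le {Φ : Config N → ℂ} (hΦ : IsCore Φ) (α : ℝ) (j : Fin N)
    (k : Fin 2) (x : Config N) :
    |fderiv ℝ (fun x => ‖Φ x‖ ^ 2) x (Pi.single j (EuclideanSpace.single k (1 : ℝ)))| ≤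
      2 * (‖Φ x‖ * ‖magDeriv α Φ j k x‖) := by
  have h := (hΦ.differentiable x).hasFDerivAt.norm_sq.fderiv
  have h1 : fderiv ℝ (fun x => ‖Φ x‖ ^ 2) x (Pi.single j (EuclideanSpace.single k (1 : ℝ))) =
      2 * (Complex.I * magDeriv α Φ j k x * (starRingEnd ℂ) (Φ x)).re := by
    rw [h]
    simp only [_root_.smul_apply, ContinuousLinearMap.comp_apply, innerSL_apply_apply,
      Complex.inner, magDeriv, partialDeriv]
    simp [Complex.mul_re, Complex.mul_im]
    ring
  rw [h1, abs_mul, abs_of_pos (zero_lt_two' ℝ)]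
  refine mul_le_mul_of_nonneg_left ((Complex.abs_re_le_norm _).trans_eq ?_) zero_le_two
  simp [mul_comm]

theorem isCompact_domainPow {Ω : Set Plane} (h : IsCompact Ω) : IsCompact (domainPow N Ω) := by
  have : domainPow N Ω = Set.univ.pi fun _ => Ω := by
    ext x; simp [domainPow]
  rw [this]
  exact isCompact_univ_pi fun _ => h

theorem isCompact_halfBox (a : Plane) : IsCompact (halfBox a) := by
  have : halfBox a = (EuclideanSpace.equiv (Fin 2) ℝ).toHomeomorph ⁻¹'
      Set.univ.pi fun i => Set.Icc (a i) (a i + 1 / 2) := by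
    ext x
    simp only [halfBox, Set.mem_ofPred_eq, Set.mem_preimage, Set.mem_univ_pi]
    rfl
  rw [this, Homeomorph.isCompact_preimage]
  exact isCompact_univ_pi fun _ => isCompact_Icc

/-- The horizontal translation of the particle `j` by `r`. -/
noncomputable def horizontal (j : Fin N) (r : ℝ) : Config N :=
  Pi.single j (EuclideanSpace.single (0 : Fin 2) r)

theorem smul_horizontal (j : Fin N) (t r : ℝ) :
    t • horizontal j r = horizontal j (t * r) := by
  rw [horizontal, ← Pi.single_smul, horizontal]
  congr 1
  ext i
  by_cases h : i = 0 <;> simp [h]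

/-- The horizontal displacement which moves the quadrant `q` to its horizontal neighbour. -/
noncomputable def displacement (q : Bool × Bool) : ℝ := if q.1 then -1 / 2 else 1 / 2

theorem abs_displacement (q : Bool × Bool) : |displacement q| = 1 / 2 := by
  unfold displacement
  split_ifs <;> norm_num [abs_div]

theorem add_single_apply_self (x : Config N) (j : Fin N) (r : ℝ) (i : Fin 2) :
    (x + horizontal j r) j i = x j i + if i = 0 then r else 0 := by
  by_cases h : i = 0 <;> simp [horizontal, h]

theorem add_displacement_mem {q : Bool × Bool} {x : Config N}
    (hx : x ∈ domainPow N (quadrant q)) (j : Fin N) {t : ℝ} (ht : t ∈ Set.Icc (0 : ℝ) 1) :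
    x + t • horizontal j (displacement q) ∈ domainPow N unitSquare := by
  rw [smul_horizontal]
  intro k
  by_cases hk : k = j
  · subst hk
    have hq := mem_quadrant.1 (hx k)
    rw [mem_unitSquare, add_single_apply_self, add_single_apply_self]
    obtain ⟨t0, t1⟩ := ht
    obtain ⟨⟨h1, h2⟩, h3, h4⟩ := hq
    simp only [displacement, if_true, one_ne_zero, if_false, add_zero, Set.mem_Icc]
    refine ⟨⟨?_, ?_⟩, ?_, ?_⟩ <;> split_ifs at * <;> linarith
  · have : (x + horizontal j (t * displacement q)) k = x k := by
      simp [horizontal, hk]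
    rw [this]
    exact quadrant_subset_unitSquare q (hx k)

/-- A closed quadrant meets its horizontal translate only on the vertical midline. -/
theorem add_displacement_notMem {q : Bool × Bool} {x : Config N}
    (hx : x ∈ domainPow N (quadrant q)) (j : Fin N)
    (h : (x + horizontal j (displacement q)) j 0 ≠ 1 / 2) :
    (x + horizontal j (displacement q)) j ∉ quadrant q := by
  intro hm
  have hq := (mem_quadrant.1 (hx j)).1
  have hm' := (mem_quadrant.1 hm).1
  rw [add_single_apply_self] at h hm'
  obtain ⟨h1, h2⟩ := hq
  obtain ⟨h3, h4⟩ := hm'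
  apply h
  simp only [displacement, if_true] at *
  split_ifs at * <;> linarith

/-! ### Weights -/

theorem card_weight_le {b : ℕ → ℝ} {m : ℝ} (hm : 0 ≤ m) (hN : 5 ≤ N) (hb0 : ∀ n, 0 ≤ b n)
    (hb : ∀ n, 2 ≤ n → n < N → n * m ≤ 4 * b n) {c : Bool × Bool → ℕ} (hc : ∑ q, c q = N)
    (hlt : ∀ q, c q < N) : ((N : ℝ) - 3) * m ≤ ∑ q, 4 * b (c q) := by
  -- Number of particles of a quadrant that contribute to the bound: a lone particle is given no
  -- energy.
  let t : ℕ → ℕ := fun n => if n < 2 then 0 else n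
  have h1 : ∀ q, (t (c q) : ℝ) * m ≤ 4 * b (c q) := by
    intro q
    simp only [t]
    split_ifs with h
    · simpa using hb0 (c q)
    · exact hb _ (not_lt.1 h) (hlt q)
  -- Four lone particles would force N = 4, so N ≥ 5 leaves at most three.
  have h2 : N ≤ ∑ q, t (c q) + 3 := by
    simp only [Fintype.sum_prod_type, Fintype.sum_bool, t] at hc ⊢
    split_ifs <;> omega
  have h3 : (N : ℝ) - 3 ≤ ∑ q, (t (c q) : ℝ) := by
    have : (N : ℝ) ≤ ∑ q, (t (c q) : ℝ) + 3 := by exact_mod_cast h2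
    linarith
  calc ((N : ℝ) - 3) * m ≤ (∑ q, (t (c q) : ℝ)) * m := mul_le_mul_of_nonneg_right h3 hm
    _ = ∑ q, (t (c q) : ℝ) * m := Finset.sum_mul _ _ _
    _ ≤ _ := Finset.sum_le_sum fun q _ => h1 q

theorem sum_card_occupants {x : Config N} (hx : x ∈ domainPow N unitSquare)
    (h : ∀ j i, x j i ≠ 1 / 2) : ∑ q, (occupants q x).card = N := by
  have := sum_occupants hx h fun _ => (1 : ℕ)
  simp only [Finset.sum_const, smul_eq_mul, mul_one, Finset.card_univ, Fintype.card_fin] at this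
  exact this

theorem card_occupants_lt {x : Config N} (hne : ∀ q, x ∉ domainPow N (quadrant q))
    (q : Bool × Bool) :
    (occupants q x).card < N := by
  refine lt_of_le_of_ne (by simpa using (occupants q x).card_le_univ) fun hc => hne q fun j => ?_
  have : occupants q x = Finset.univ := by
    rw [← Finset.card_eq_iff_eq_univ, hc, Fintype.card_fin]
  rw [← mem_occupants, this]
  exact Finset.mem_univ j

/-- The assumptions on the weights `b` and the number `m` used in the induction step. -/
structure IsWeight (N : ℕ) (b : ℕ → ℝ) (m : ℝ) : Prop where
  five_le : 5 ≤ N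
  nonneg : ∀ n, 0 ≤ b n
  le : ∀ n, 2 ≤ n → n < N → n * m ≤ 4 * b n

theorem IsWeight.le_sum {b : ℕ → ℝ} {m : ℝ} (hw : IsWeight N b m) (hm : 0 ≤ m) {x : Config N}
    (hx : x ∈ domainPow N unitSquare) (h : ∀ j i, x j i ≠ 1 / 2)
    (hne : ∀ q, x ∉ domainPow N (quadrant q)) :
    ((N : ℝ) - 3) * m ≤ ∑ q, 4 * b (occupants q x).card :=
  card_weight_le hm hw.five_le hw.nonneg hw.le (sum_card_occupants hx h)
    (card_occupants_lt hne)

theorem IsWeight.sum_nonneg {b : ℕ → ℝ} {m : ℝ} (hw : IsWeight N b m) (x : Config N) :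
    0 ≤ ∑ q, 4 * b (occupants q x).card :=
  Finset.sum_nonneg fun _ _ => mul_nonneg zero_le_four (hw.nonneg _)

theorem IsWeight.min_le_sum {b : ℕ → ℝ} {m : ℝ} (hw : IsWeight N b m) (hm : 0 ≤ m)
    {x : Config N} (hx : x ∈ domainPow N unitSquare) (h : ∀ j i, x j i ≠ 1 / 2) :
    min (4 * b N) (((N : ℝ) - 3) * m) ≤ ∑ q, 4 * b (occupants q x).card := by
  by_cases hne : ∀ q, x ∉ domainPow N (quadrant q)
  · exact (min_le_right _ _).trans (hw.le_sum hm hx h hne)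
  · push Not at hne
    obtain ⟨q, hq⟩ := hne
    have hc : (occupants q x).card = N := by
      have : occupants q x = Finset.univ := by
        ext j; simpa using hq j
      simp [this]
    refine (min_le_left _ _).trans ?_
    calc 4 * b N = 4 * b (occupants q x).card := by rw [hc]
      _ ≤ _ := Finset.single_le_sum (f := fun q => 4 * b (occupants q x).card)
        (fun q _ => mul_nonneg zero_le_four (hw.nonneg _)) (Finset.mem_univ q)

/-- A bound which is self-improving when `b N` is positive. -/
theorem IsWeight.coreBound_min {α : ℝ} {b : ℕ → ℝ} {m : ℝ} (hw : IsWeight N b m) (hm : 0 ≤ m)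
    (hb : ∀ n ≤ N, CoreBound n α unitSquare (b n)) :
    CoreBound N α unitSquare (min (4 * b N) (((N : ℝ) - 3) * m)) := by
  intro Φ hΦ
  refine le_trans ?_ (setIntegral_occupants_le hb hΦ)
  rw [← integral_const_mul]
  refine setIntegral_mono_on_ae (hΦ.integrable_norm_sq.const_mul _).integrableOn
    (integrable_occupants_mass hΦ b).integrableOn
    (measurableSet_domainPow isClosed_unitSquare.measurableSet) ?_
  filter_upwards [ae_coord_ne (N := N) (1 / 2)] with x hx hxU
  exact mul_le_mul_of_nonneg_right (hw.min_le_sum hm hxU hx) (sq_nonneg _)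

theorem IsWeight.two_mul_le {b : ℕ → ℝ} {m : ℝ} (hw : IsWeight N b m) (hm : 0 ≤ m) :
    2 * m ≤ ((N : ℝ) - 3) * m := by
  have : (5 : ℝ) ≤ N := by exact_mod_cast hw.five_le
  exact mul_le_mul_of_nonneg_right (by linarith) hm

/-- After the move, particle j has left q while the others are still there. The displaced
configuration thus occupies several quadrants and has weight at least 2m. -/
theorem IsWeight.setIntegral_displaced_le {b : ℕ → ℝ} {m : ℝ} (hw : IsWeight N b m)
    (hm : 0 ≤ m) {Φ : Config N → ℂ} (hΦ : IsCore Φ) (q : Bool × Bool) (j : Fin N) :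
    2 * m * ∫ x in domainPow N (quadrant q),
        ‖Φ (x + horizontal j (displacement q))‖ ^ 2 ≤
      ∫ x in domainPow N unitSquare, (∑ q, 4 * b (occupants q x).card) * ‖Φ x‖ ^ 2 := by
  set v := horizontal j (displacement q) with hv
  have hK := measurableSet_domainPow (N := N) (isClosed_halfBox (corner q)).measurableSet
  have hi := integrable_occupants_mass hΦ b
  have hadd : ∀ x ∈ domainPow N (quadrant q), x + v ∈ domainPow N unitSquare := fun x hx => by
    simpa using add_displacement_mem hx j (t := 1) ⟨zero_le_one, le_rfl⟩
  refine le_trans ?_ (setIntegral_comp_add_right_le hi hK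
    (measurableSet_domainPow isClosed_unitSquare.measurableSet)
    (fun y _ => mul_nonneg (hw.sum_nonneg y) (sq_nonneg _)) v hadd)
  rw [← integral_const_mul]
  refine setIntegral_mono_on_ae
    ((hΦ.integrable_norm_sq.comp_add_right v).const_mul _).integrableOn
    (hi.comp_add_right v).integrableOn hK ?_
  have hae := (measurePreserving_add_right (volume : Measure (Config N)) v
    ).quasiMeasurePreserving.ae (ae_coord_ne (N := N) (1 / 2))
  filter_upwards [hae] with x hx hxK
  refine mul_le_mul_of_nonneg_right ?_ (sq_nonneg _)
  refine (hw.two_mul_le hm).trans (hw.le_sum hm (hadd x hxK) hx fun q' hq' => ?_)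
  have hjq := add_displacement_notMem hxK j (hx j 0)
  have : Nontrivial (Fin N) := Fin.nontrivial_iff_two_le.2 (by linarith [hw.five_le])
  obtain ⟨k, hk⟩ := exists_ne j
  have hkx : (x + v) k = x k := by simp [hv, horizontal, hk]
  obtain ⟨q₀, -, hu⟩ := existsUnique_mem_quadrant (hadd x hxK k) (hx k)
  have e1 := hu q (by rw [hkx]; exact hxK k)
  have e2 := hu q' (hq' k)
  have hj := hq' j
  rw [e2.trans e1.symm] at hj
  exact hjq hj

/-- Almost every configuration either lies in a single quadrant or has weight at least 2m. -/
theorem IsWeight.mass_le {b : ℕ → ℝ} {m : ℝ} (hw : IsWeight N b m)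
    (hm : 0 ≤ m) {Φ : Config N → ℂ} (hΦ : IsCore Φ) :
    2 * m * ∫ x in domainPow N unitSquare, ‖Φ x‖ ^ 2 ≤
      2 * m * (∑ q, ∫ x in domainPow N (quadrant q), ‖Φ x‖ ^ 2) +
      ∫ x in domainPow N unitSquare, (∑ q, 4 * b (occupants q x).card) * ‖Φ x‖ ^ 2 := by
  have hU := measurableSet_domainPow (N := N) isClosed_unitSquare.measurableSet
  have hK : ∀ q, MeasurableSet (domainPow N (quadrant q)) := fun q =>
    measurableSet_domainPow (N := N) (isClosed_halfBox (corner q)).measurableSet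
  have hi := integrable_occupants_mass hΦ b
  have hind : ∀ q, Integrable ((domainPow N (quadrant q)).indicator fun x => ‖Φ x‖ ^ 2) :=
    fun q => hΦ.integrable_norm_sq.indicator (hK q)
  have e : ∀ q, ∫ x in domainPow N (quadrant q), ‖Φ x‖ ^ 2 =
      ∫ x in domainPow N unitSquare,
        (domainPow N (quadrant q)).indicator (fun x => ‖Φ x‖ ^ 2) x := by
    intro q
    have hsub : domainPow N (quadrant q) ⊆ domainPow N unitSquare := fun x hx j =>
      quadrant_subset_unitSquare q (hx j)
    rw [integral_indicator (hK q), Measure.restrict_restrict (hK q), Set.inter_eq_left.2 hsub]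
  simp only [e]
  rw [← integral_finsetSum _ fun q _ => (hind q).integrableOn, ← integral_const_mul,
    ← integral_const_mul, ← integral_add
      ((integrable_finsetSum _ fun q _ => hind q).const_mul _).integrableOn hi.integrableOn]
  refine setIntegral_mono_on_ae (hΦ.integrable_norm_sq.const_mul _).integrableOn
    (((integrable_finsetSum _ fun q _ => hind q).const_mul _).add hi).integrableOn hU ?_
  filter_upwards [ae_coord_ne (N := N) (1 / 2)] with x hx hxU
  have hn : ∀ q, 0 ≤ (domainPow N (quadrant q)).indicator (fun x => ‖Φ x‖ ^ 2) x := fun q =>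
    Set.indicator_nonneg (fun x _ => sq_nonneg _) x
  have hs := mul_nonneg (hw.sum_nonneg x) (sq_nonneg ‖Φ x‖)
  by_cases hne : ∀ q, x ∉ domainPow N (quadrant q)
  · have h1 := mul_le_mul_of_nonneg_right
      ((hw.two_mul_le hm).trans (hw.le_sum hm hxU hx hne)) (sq_nonneg ‖Φ x‖)
    have h2 := mul_nonneg (mul_nonneg zero_le_two hm) 
      (Finset.sum_nonneg fun q (_ : q ∈ Finset.univ) => hn q)
    linarith
  · push Not at hne
    obtain ⟨q, hq⟩ := hne
    have h1 := Finset.single_le_sum (fun q _ => hn q) (Finset.mem_univ q)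
    rw [Set.indicator_of_mem hq] at h1
    have h2 := mul_le_mul_of_nonneg_left h1 (mul_nonneg zero_le_two hm)
    linarith

theorem IsCore.mass_quadrant_le {Φ : Config N → ℂ} (hΦ : IsCore Φ) (α : ℝ) (q : Bool × Bool)
    (j : Fin N) :
    ∫ x in domainPow N (quadrant q), ‖Φ x‖ ^ 2 ≤
      (∫ x in domainPow N (quadrant q), ‖Φ (x + horizontal j (displacement q))‖ ^ 2) +
      (1 / 8 * (∫ x in domainPow N unitSquare, ‖Φ x‖ ^ 2) +
        2 * ∫ x in domainPow N unitSquare, ∑ j, kinetic α Φ j x) := by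
  have hkin : Integrable fun x => ∑ j, kinetic α Φ j x :=
    integrable_finsetSum _ fun j _ => hΦ.integrable_kinetic α j
  have i1 := hΦ.integrable_norm_sq.const_mul (1 / 8)
  have i2 := hkin.const_mul 2
  have hf : ContDiff ℝ 1 fun x => ‖Φ x‖ ^ 2 := (hΦ.smooth.of_le (by simp)).norm_sq ℝ
  have hg : Continuous fun x => 1 / 8 * ‖Φ x‖ ^ 2 + 2 * ∑ j, kinetic α Φ j x :=
    (continuous_const.mul (hΦ.continuous.norm.pow 2)).add
      (continuous_const.mul (continuous_finsetSum _ fun j _ => hΦ.continuous_kinetic α j))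
  rw [← integral_const_mul, ← integral_const_mul,
    ← integral_add i1.integrableOn i2.integrableOn]
  refine setIntegral_le_setIntegral_comp_add hf _ hg (i1.add i2) (fun x => ?_)
    (isCompact_domainPow (isCompact_halfBox _))
    (measurableSet_domainPow isClosed_unitSquare.measurableSet)
    fun x hx t ht => add_displacement_mem hx j ht
  have e : horizontal j (displacement q) = displacement q • horizontal j 1 := by
    rw [smul_horizontal, mul_one]
  rw [e, horizontal, map_smul, smul_eq_mul, abs_mul, abs_displacement]
  have h1 := hΦ.abs_fderiv_norm_sq_le α j 0 x
  have h2 : ‖magDeriv α Φ j 0 x‖ ^ 2 ≤ ∑ j, kinetic α Φ j x :=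
    (Finset.single_le_sum (f := fun k => ‖magDeriv α Φ j k x‖ ^ 2) (fun k _ => sq_nonneg _)
      (Finset.mem_univ 0)).trans
      (Finset.single_le_sum (f := fun j => kinetic α Φ j x)
        (fun j _ => kinetic_nonneg α Φ j x) (Finset.mem_univ j))
  -- AM-GM in the form ab ≤ a²/8 + 2b². The 1/8 is small enough that four quadrants cost only half
  -- of the total mass.
  nlinarith [sq_nonneg (‖Φ x‖ - 4 * ‖magDeriv α Φ j 0 x‖)]

/-- The energy is positive if the weights are. -/
theorem IsWeight.exists_coreBound_pos {α : ℝ} {b : ℕ → ℝ} {m : ℝ} (hw : IsWeight N b m)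
    (hm : 0 < m) (hb : ∀ n ≤ N, CoreBound n α unitSquare (b n)) :
    ∃ δ > 0, CoreBound N α unitSquare δ := by
  -- With mass M and energy ε, the estimates below combine to 2mM ≤ ε + 4(ε + mM/4 + 4mε), that is,
  -- mM ≤ (5 + 16m) ε.
  refine ⟨m / (5 + 16 * m), by positivity, fun Φ hΦ => ?_⟩
  have j : Fin N := ⟨0, by linarith [hw.five_le]⟩
  have h1 := setIntegral_occupants_le hb hΦ
  have h2 := hw.mass_le hm.le hΦ
  have h3 := fun q => hw.setIntegral_displaced_le hm.le hΦ q j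
  have h4 := fun q => mul_le_mul_of_nonneg_left (hΦ.mass_quadrant_le α q j)
    (mul_nonneg zero_le_two hm.le)
  set M := ∫ x in domainPow N unitSquare, ‖Φ x‖ ^ 2
  set ε := ∫ x in domainPow N unitSquare, ∑ j, kinetic α Φ j x
  have h5 : 2 * m * ∑ q, ∫ x in domainPow N (quadrant q), ‖Φ x‖ ^ 2 ≤
      ∑ _q : Bool × Bool, (ε + 2 * m * (1 / 8 * M + 2 * ε)) := by
    rw [Finset.mul_sum]
    refine Finset.sum_le_sum fun q _ => ?_
    linarith [h3 q, h4 q]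
  simp only [Finset.sum_const, Finset.card_univ, Fintype.card_prod, Fintype.card_bool,
    nsmul_eq_mul] at h5
  push_cast at h5
  rw [div_mul_eq_mul_div, div_le_iff₀ (by positivity)]
  linarith

/-! ### The induction -/

theorem neumannEnergy_ge (α : ℝ) {m : ℝ} (hm : 0 ≤ m) (h2 : m ≤ neumannEnergy 2 α)
    (h3 : m ≤ neumannEnergy 3 α) (h4 : m ≤ neumannEnergy 4 α) :
    ∀ N : ℕ, 2 ≤ N → (N : ℝ) / 4 * m ≤ neumannEnergy N α := by
  intro N
  induction N using Nat.strong_induction_on with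
  | _ N ih =>
  intro hN
  rcases lt_or_ge N 5 with h5 | h5
  · interval_cases N <;> norm_num <;> linarith
  -- For n < 2 the trivial bound 0 suffices. The value at N itself is the unknown energy.
  let b : ℕ → ℝ := fun n => if n < 2 then 0 else neumannEnergy n α
  have hb : ∀ n ≤ N, CoreBound n α unitSquare (b n) := by
    intro n _
    simp only [b]
    split_ifs
    · exact coreBound_zero n α unitSquare
    · exact coreBound_neumannEnergyOn n α unitSquare
  have hbN : b N = neumannEnergy N α := if_neg (by omega)
  have hw : IsWeight N b m := by
    refine ⟨h5, fun n => ?_, fun n hn hnN => ?_⟩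
    · simp only [b]
      split_ifs
      · exact le_rfl
      · exact neumannEnergyOn_nonneg n α unitSquare
    · simp only [b, if_neg (not_lt.2 hn)]
      linarith [ih n hnN hn]
  have hN5 : (5 : ℝ) ≤ N := by exact_mod_cast h5
  rcases hm.eq_or_lt with h0 | h0
  · rw [← h0, mul_zero]
    exact neumannEnergyOn_nonneg N α unitSquare
  obtain ⟨δ, hδ, hδb⟩ := hw.exists_coreBound_pos h0 hb
  have hpos : 0 < neumannEnergy N α := hδ.trans_le hδb.le_neumannEnergy
  have hmin := (hw.coreBound_min hm hb).le_neumannEnergy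
  rw [hbN, min_le_iff] at hmin
  -- The first alternative, 4 E_N ≤ E_N, contradicts positivity; the second suffices since N - 3 ≥
  -- N/4 for N ≥ 4.
  rcases hmin with h | h
  · linarith
  · nlinarith

end Anyon

theorem mainTheorem5 (α : ℝ) (hα₀ : 0 ≤ α) (hα₁ : α ≤ 1) (N : ℕ) (hN : 2 ≤ N) :
    (N : ℝ) / 4 *
        min (Anyon.neumannEnergy 2 α) (min (Anyon.neumannEnergy 3 α) (Anyon.neumannEnergy 4 α))
      ≤ Anyon.neumannEnergy N α :=
  Anyon.neumannEnergy_ge α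
    (le_min (Anyon.neumannEnergyOn_nonneg 2 α _) (le_min (Anyon.neumannEnergyOn_nonneg 3 α _)
      (Anyon.neumannEnergyOn_nonneg 4 α _)))
    (min_le_left _ _) ((min_le_right _ _).trans (min_le_left _ _))
    ((min_le_right _ _).trans (min_le_right _ _)) N hN
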